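/- Let $T>0$. For $v,w\in L^2(0,T)$ put $v_k=\frac2T\int_0^T v(t)\sin\big((\tfrac\pi2+k\pi)\tfrac tT\big)\,dt$ and $\overline w_k=\frac2T\int_0^T w(t)\cos\big((\tfrac\pi2+k\pi)\tfrac tT\big)\,dt$, $k\ge 0$, and let $$\mathcal H_Tv=\sum_{k\ge0}v_k\cos\big((\tfrac\pi2+k\pi)\tfrac tT\big),\qquad \mathcal H_T^{-1}w=\sum_{k\ge0}\overline w_k\sin\big((\tfrac\pi2+k\pi)\tfrac tT\big)\qquad\text{in }L^2(0,T).$$ For an integer $n\ge1$ let $h=T/n$, let $S_h^0(0,T)$ be the space of functions that are constant on each interval $((i-1)h,ih)$, $i=1,\dots,n$, and let $Q_h$ be the $L^2(0,T)$-orthogonal projection onto $S_h^0(0,T)$. For $v\in S_h^0(0,T)$ define $$c_S(v)=\frac{2\sqrt3}{\pi^2}\,\frac{16n^2-8n(2M+1)}{(4n-(2M+1))^2},\qquad M=\min\Big\{m\in\mathbb N_0:\ \|v\|^2_{L^2(0,T)}\le\frac T2\,\frac{\pi^2}{3}\sum_{k=0}^m\overline v_k^2\Big\}.$$ The spaces $H^s(0,T)$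 are the usual Sobolev spaces: for $s\in\{0,1,2\}$ with $\|u\|_{H^s(0,T)}^2=\sum_{j\le s}\|\partial_t^ju\|_{L^2(0,T)}^2$ (weak derivatives), for $0<s<1$ with the Sobolev--Slobodeckij norm $\|u\|_{H^s(0,T)}^2=\|u\|_{L^2(0,T)}^2+\int_0^T\!\int_0^T\frac{|u(x)-u(y)|^2}{|x-y|^{1+2s}}\,dx\,dy$. There is a constant $c>0$, depending only on $T$, such that for every $n\ge1$ and every $u\in L^2(0,T)$ the following holds. There is a unique $u_h\in S_h^0(0,T)$ with $$\langle u_h,\mathcal H_Tv_h\rangle_{L^2(0,T)}=\langle u,\mathcal H_Tv_h\rangle_{L^2(0,T)}\qquad\text{for all }v_h\in S_h^0(0,T).$$ If $u\in H^s(0,T)$ for some $s\in[0,1]$, then $$\|u-u_h\|_{L^2(0,T)}\le c\left[h^s\|u\|_{H^s(0,T)}+\frac{\|Q_h\mathcal H_T^{-1}(u-Q_hu)\|_{L^2(0,T)}}{c_S(u_h-Q_hu)}\right].$$ If $u\in H^2(0,T)$ and $\partial_tu(0)=0$, then $$\|u-u_h\|_{L^2(0,T)}\le c\,h\,\|u\|_{H^2(0,T)}.$$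 -/

import Mathlib

open MeasureTheory Set
open scoped ENNReal

noncomputable section

namespace ModHilbert

/-- The real Hilbert space `L²(0,T)`. -/
abbrev L2 (T : ℝ) : Type := Lp ℝ 2 (volume.restrict (Ioo (0 : ℝ) T))

/-! ### The modified Hilbert transformation -/

/-- The frequency `(π/2 + kπ) / T`. -/
def freq (T : ℝ) (k : ℕ) : ℝ := (Real.pi / 2 + k * Real.pi) / T

theorem memLp_sin (T : ℝ) (k : ℕ) :
    MemLp (fun t : ℝ => Real.sin (freq T k * t)) 2 (volume.restrict (Ioo (0 : ℝ) T)) :=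
  MemLp.of_bound (by fun_prop) 1 (Filter.Eventually.of_forall fun t => by
    simpa using Real.abs_sin_le_one (freq T k * t))

theorem memLp_cos (T : ℝ) (k : ℕ) :
    MemLp (fun t : ℝ => Real.cos (freq T k * t)) 2 (volume.restrict (Ioo (0 : ℝ) T)) :=
  MemLp.of_bound (by fun_prop) 1 (Filter.Eventually.of_forall fun t => by
    simpa using Real.abs_cos_le_one (freq T k * t))

/-- `t ↦ sin((π/2 + kπ) t/T)` as an element of `L²(0,T)`. -/
def sinL2 (T : ℝ) (k : ℕ) : L2 T := (memLp_sin T k).toLp _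

/-- `t ↦ cos((π/2 + kπ) t/T)` as an element of `L²(0,T)`. -/
def cosL2 (T : ℝ) (k : ℕ) : L2 T := (memLp_cos T k).toLp _

/-- The sine coefficient `v_k = (2/T) ∫₀ᵀ v(t) sin((π/2 + kπ) t/T) dt`. -/
def sinCoeff (T : ℝ) (v : L2 T) (k : ℕ) : ℝ :=
  2 / T * ∫ t in Ioo 0 T, v t * Real.sin (freq T k * t)

/-- The cosine coefficient `(2/T) ∫₀ᵀ w(t) cos((π/2 + kπ) t/T) dt`. -/
def cosCoeff (T : ℝ) (w : L2 T) (k : ℕ) : ℝ :=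
  2 / T * ∫ t in Ioo 0 T, w t * Real.cos (freq T k * t)

theorem inner_sinL2_left (T : ℝ) (k : ℕ) (v : L2 T) :
    inner ℝ (sinL2 T k) v = ∫ t in Ioo 0 T, v t * Real.sin (freq T k * t) := by
  rw [L2.inner_def]
  refine integral_congr_ae ?_
  filter_upwards [(memLp_sin T k).coeFn_toLp] with t ht
  simp only [sinL2, ht]
  rfl

theorem inner_cosL2_left (T : ℝ) (k : ℕ) (v : L2 T) :
    inner ℝ (cosL2 T k) v = ∫ t in Ioo 0 T, v t * Real.cos (freq T k * t) := by
  rw [L2.inner_def]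
  refine integral_congr_ae ?_
  filter_upwards [(memLp_cos T k).coeFn_toLp] with t ht
  simp only [cosL2, ht]
  rfl

theorem integral_cos_int (T : ℝ) (hT : 0 < T) (m : ℤ) (hm : m ≠ 0) :
    ∫ t in (0 : ℝ)..T, Real.cos (m * Real.pi / T * t) = 0 := by
  have hc : (m * Real.pi / T : ℝ) ≠ 0 := by
    have : (m : ℝ) ≠ 0 := by exact_mod_cast hm
    have := Real.pi_ne_zero
    positivity
  rw [intervalIntegral.integral_comp_mul_left (fun x => Real.cos x) hc, integral_cos]
  have : (m * Real.pi / T : ℝ) * T = m * Real.pi := by field_simp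
  rw [this, Real.sin_int_mul_pi]
  simp

theorem inner_trig (T : ℝ) (hT : 0 < T) (k l : ℕ) :
    inner ℝ (sinL2 T k) (sinL2 T l) = (if k = l then T / 2 else 0) ∧
      inner ℝ (cosL2 T k) (cosL2 T l) = (if k = l then T / 2 else 0) := by
  have hI : ∀ m : ℤ, ∫ t in (0 : ℝ)..T, Real.cos (m * Real.pi / T * t) =
      if m = 0 then T else 0 := by
    intro m
    split_ifs with h
    · simp [h]
    · exact integral_cos_int T hT m h
  have hi : ∀ m : ℤ, IntervalIntegrable (fun t : ℝ => Real.cos (m * Real.pi / T * t)) volume 0 T :=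
    fun m => Continuous.intervalIntegrable (by fun_prop) _ _
  have hd := hI ((k : ℤ) - l)
  have hs := hI ((k : ℤ) + l + 1)
  rw [if_neg (by positivity)] at hs
  have e1 : (if (k : ℤ) - l = 0 then T else 0) = if k = l then T else 0 := by
    congr 1
    simp [sub_eq_zero]
  rw [e1] at hd
  constructor
  · rw [inner_sinL2_left]
    have : ∫ t in Ioo 0 T, (sinL2 T l) t * Real.sin (freq T k * t) =
        ∫ t in Ioo 0 T, (1 / 2 * (Real.cos (((k : ℤ) - l : ℤ) * Real.pi / T * t) -
          Real.cos (((k : ℤ) + l + 1 : ℤ) * Real.pi / T * t)) : ℝ) := by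
      refine integral_congr_ae ?_
      filter_upwards [(memLp_sin T l).coeFn_toLp] with t ht
      simp only [sinL2, ht]
      simp only [freq]
      rw [show (((k : ℤ) - l : ℤ) * Real.pi / T * t : ℝ) = (Real.pi / 2 + k * Real.pi) / T * t -
          (Real.pi / 2 + l * Real.pi) / T * t by push_cast; ring,
        show (((k : ℤ) + l + 1 : ℤ) * Real.pi / T * t : ℝ) = (Real.pi / 2 + k * Real.pi) / T * t +
          (Real.pi / 2 + l * Real.pi) / T * t by push_cast; ring, Real.cos_sub, Real.cos_add]
      ring
    rw [this, ← integral_Ioc_eq_integral_Ioo, ← intervalIntegral.integral_of_le hT.le,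
      intervalIntegral.integral_const_mul, intervalIntegral.integral_sub (hi _) (hi _), hd, hs]
    split_ifs <;> ring
  · rw [inner_cosL2_left]
    have : ∫ t in Ioo 0 T, (cosL2 T l) t * Real.cos (freq T k * t) =
        ∫ t in Ioo 0 T, (1 / 2 * (Real.cos (((k : ℤ) - l : ℤ) * Real.pi / T * t) +
          Real.cos (((k : ℤ) + l + 1 : ℤ) * Real.pi / T * t)) : ℝ) := by
      refine integral_congr_ae ?_
      filter_upwards [(memLp_cos T l).coeFn_toLp] with t ht
      simp only [cosL2, ht]
      simp only [freq]
      rw [show (((k : ℤ) - l : ℤ) * Real.pi / T * t : ℝ) = (Real.pi / 2 + k * Real.pi) / T * t -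
          (Real.pi / 2 + l * Real.pi) / T * t by push_cast; ring,
        show (((k : ℤ) + l + 1 : ℤ) * Real.pi / T * t : ℝ) = (Real.pi / 2 + k * Real.pi) / T * t +
          (Real.pi / 2 + l * Real.pi) / T * t by push_cast; ring, Real.cos_sub, Real.cos_add]
      ring
    rw [this, ← integral_Ioc_eq_integral_Ioo, ← intervalIntegral.integral_of_le hT.le,
      intervalIntegral.integral_const_mul, intervalIntegral.integral_add (hi _) (hi _), hd, hs]
    split_ifs <;> ring

theorem summable_of_orthogonal {E : Type*} [NormedAddCommGroup E] [InnerProductSpace ℝ E]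
    [CompleteSpace E] (a : ℝ) (ha : 0 < a) (e f : ℕ → E)
    (he : ∀ k l, inner ℝ (e k) (e l) = if k = l then a else 0)
    (hf : ∀ k l, inner ℝ (f k) (f l) = if k = l then a else 0) (v : E) :
    Summable fun k => inner ℝ (e k) v • f k := by
  have key : ∀ g : ℕ → E, (∀ k l, inner ℝ (g k) (g l) = if k = l then a else 0) →
      Orthonormal ℝ fun k => (Real.sqrt a)⁻¹ • g k := by
    intro g hg
    rw [orthonormal_iff_ite]
    intro k l
    rw [real_inner_smul_left, real_inner_smul_right, hg]
    have : Real.sqrt a * Real.sqrt a = a := Real.mul_self_sqrt ha.le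
    have h0 : Real.sqrt a ≠ 0 := (Real.sqrt_pos.2 ha).ne'
    split_ifs
    · field_simp
      nlinarith
    · simp
  have h1 := (key e he).inner_products_summable (x := v)
  have h2 := ((key f hf).orthogonalFamily.summable_iff_norm_sq_summable
    fun k => inner ℝ ((Real.sqrt a)⁻¹ • e k) v).2 h1
  have h3 := h2.const_smul a
  refine h3.congr fun k => ?_
  simp only [LinearIsometry.toSpanSingleton_apply, real_inner_smul_left, smul_smul]
  have : Real.sqrt a * Real.sqrt a = a := Real.mul_self_sqrt ha.le
  have h0 : Real.sqrt a ≠ 0 := (Real.sqrt_pos.2 ha).ne'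
  congr 1
  field_simp
  rw [pow_two, this]

theorem summable_hilbT (T : ℝ) (hT : 0 < T) (v : L2 T) :
    Summable fun k : ℕ => sinCoeff T v k • cosL2 T k := by
  have h := (summable_of_orthogonal (T / 2) (by positivity) (sinL2 T) (cosL2 T)
    (fun k l => (inner_trig T hT k l).1) (fun k l => (inner_trig T hT k l).2) v).const_smul (2 / T)
  refine h.congr fun k => ?_
  rw [smul_smul, inner_sinL2_left, sinCoeff]

theorem summable_hilbTInv (T : ℝ) (hT : 0 < T) (w : L2 T) :
    Summable fun k : ℕ => cosCoeff T w k • sinL2 T k := by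
  have h := (summable_of_orthogonal (T / 2) (by positivity) (cosL2 T) (sinL2 T)
    (fun k l => (inner_trig T hT k l).2) (fun k l => (inner_trig T hT k l).1) w).const_smul (2 / T)
  refine h.congr fun k => ?_
  rw [smul_smul, inner_cosL2_left, cosCoeff]

/-- The modified Hilbert transformation: the sine series of `v` with sines replaced by cosines
(convergence in `L²(0,T)`, see `summable_hilbT`). -/
def hilbT (T : ℝ) (v : L2 T) : L2 T := ∑' k : ℕ, sinCoeff T v k • cosL2 T k

/-- The inverse modified Hilbert transformation: the cosine series of `w` with cosines replaced
by sines (convergence in `L²(0,T)`, see `summable_hilbTInv`). -/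
def hilbTInv (T : ℝ) (w : L2 T) : L2 T := ∑' k : ℕ, cosCoeff T w k • sinL2 T k

/-! ### Piecewise constant functions -/

/-- The indicator function of the `i`-th element `(i h, (i+1) h)`, `h = T/n`, in `L²(0,T)`. -/
def basisFn (T : ℝ) (n : ℕ) (i : Fin n) : L2 T :=
  indicatorConstLp 2
    (measurableSet_Ioo : MeasurableSet (Ioo ((i : ℝ) * (T / n)) (((i : ℝ) + 1) * (T / n))))
    (measure_ne_top _ _) (1 : ℝ)

/-- The space `S_h^0(0,T)`, `h = T/n`, of piecewise constant functions on the uniform mesh. -/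
def pwConst (T : ℝ) (n : ℕ) : Submodule ℝ (L2 T) := Submodule.span ℝ (range (basisFn T n))

instance instFinitePwConst (T : ℝ) (n : ℕ) : FiniteDimensional ℝ (pwConst T n) :=
  FiniteDimensional.span_of_finite ℝ (finite_range _)

/-- The `L²(0,T)`-orthogonal projection `Q_h` onto `S_h^0(0,T)`. -/
def projL2 (T : ℝ) (n : ℕ) (u : L2 T) : L2 T := (pwConst T n).starProjection u

/-- `uh ∈ S_h^0(0,T)` is the projection of `u` based on the modified Hilbert transformation:
`⟨uh, H_T vh⟩ = ⟨u, H_T vh⟩` for all `vh ∈ S_h^0(0,T)`. -/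
def IsHilbProj (T : ℝ) (n : ℕ) (u uh : L2 T) : Prop :=
  uh ∈ pwConst T n ∧
    ∀ vh ∈ pwConst T n, inner ℝ uh (hilbT T vh) = inner ℝ u (hilbT T vh)

/-! ### The stability constant -/

/-- The least `m` with `‖v‖² ≤ (T/2) (π²/3) ∑_{k=0}^m v̄_k²`, where `v̄_k` are the cosine
coefficients of `v`. -/
def cutoff (T : ℝ) (v : L2 T) : ℕ :=
  sInf {m : ℕ | ‖v‖ ^ 2 ≤
    T / 2 * (Real.pi ^ 2 / 3) * ∑ k ∈ Finset.range (m + 1), cosCoeff T v k ^ 2}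

/-- The stability constant
`c_S(v) = (2√3/π²) (16n² - 8n(2M+1)) / (4n - (2M+1))²` with `M = cutoff T v`. -/
def stabConst (T : ℝ) (n : ℕ) (v : L2 T) : ℝ :=
  2 * Real.sqrt 3 / Real.pi ^ 2 *
    ((16 * (n : ℝ) ^ 2 - 8 * n * (2 * (cutoff T v : ℝ) + 1)) /
      (4 * (n : ℝ) - (2 * (cutoff T v : ℝ) + 1)) ^ 2)

/-! ### Sobolev spaces -/

/-- `g ∈ L²(0,T)` is the weak derivative of `u ∈ L²(0,T)` on `(0,T)`. -/
def IsWeakDeriv (T : ℝ) (u g : L2 T) : Prop :=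
  ∀ φ : ℝ → ℝ, ContDiff ℝ (⊤ : ℕ∞) φ → HasCompactSupport φ → tsupport φ ⊆ Ioo 0 T →
    ∫ t in Ioo 0 T, u t * deriv φ t = -∫ t in Ioo 0 T, g t * φ t

/-- `g 0 = u` and `g 1, …, g m` are the first `m` weak derivatives of `u`. -/
def IsWeakJet (T : ℝ) (m : ℕ) (u : L2 T) (g : ℕ → L2 T) : Prop :=
  g 0 = u ∧ ∀ j < m, IsWeakDeriv T (g j) (g (j + 1))

/-- The squared Sobolev–Slobodeckij seminorm of order `σ ∈ (0,1)`:
`∫₀ᵀ ∫₀ᵀ |v(x) - v(y)|² / |x - y|^(1+2σ) dx dy`. -/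
def slobodeckijSq (T σ : ℝ) (v : L2 T) : ℝ≥0∞ :=
  ∫⁻ x in Ioo 0 T, ∫⁻ y in Ioo 0 T, ENNReal.ofReal (|v x - v y| ^ 2 / |x - y| ^ (1 + 2 * σ))

/-- The norm of `H^s(0,T)`, `s ≥ 0`, with values in `[0,∞]`. With `m = ⌊s⌋` and `σ = s - m` its
square is `∑_{j ≤ m} ‖∂^j u‖²`, plus the squared Slobodeckij seminorm of `∂^m u` of order `σ` if
`σ > 0`. It is `∞` when `u ∉ H^s(0,T)`: weak derivatives are unique, so that the infimum runs
over a single value if `∂u, …, ∂^m u ∈ L²(0,T)` exist, and over the empty set otherwise. -/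
def eSobolevNorm (T s : ℝ) (u : L2 T) : ℝ≥0∞ :=
  ⨅ (g : ℕ → L2 T) (_ : IsWeakJet T ⌊s⌋₊ u g),
    (∑ j ∈ Finset.range (⌊s⌋₊ + 1), ENNReal.ofReal (‖g j‖ ^ 2) +
      if 0 < s - ⌊s⌋₊ then slobodeckijSq T (s - ⌊s⌋₊) (g ⌊s⌋₊) else 0) ^ (1 / 2 : ℝ)

/-- `u ∈ H^s(0,T)`. -/
def MemSobolev (T s : ℝ) (u : L2 T) : Prop := eSobolevNorm T s u < ⊤

/-- The norm `‖u‖_{H^s(0,T)}` of `u ∈ H^s(0,T)`. -/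
def sobolevNorm (T s : ℝ) (u : L2 T) : ℝ := (eSobolevNorm T s u).toReal

/-- `∂ₜu(0) = 0`: the weak derivative of `u` is represented by a function that is continuous on
`[0,T]` and vanishes at `0`. -/
def DerivZeroAtZero (T : ℝ) (u : L2 T) : Prop :=
  ∃ (g : L2 T) (v : ℝ → ℝ), IsWeakDeriv T u g ∧ ContinuousOn v (Icc 0 T) ∧
    (g =ᵐ[volume.restrict (Ioo 0 T)] v) ∧ v 0 = 0

end ModHilbert

end

open ModHilbert

/-!
The modified Hilbert transformation exchanges two orthogonal families of functions, so its inverse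
is its adjoint (`inner_hilbTInv_left`), and the projection `uh` is characterised by
`Q H⁻¹ uh = Q H⁻¹ u` (`isHilbProj_iff`), where `Q` is the orthogonal projection onto the piecewise
constants. Hence `Q H⁻¹ (uh - Q u) = Q H⁻¹ (u - Q u)` (`projL2_hilbTInv_sub`), and everything depends
on bounds for the operator `Q H⁻¹` on piecewise constants.

This operator is diagonal. With `x = (2k+1)π/(4n)`, the projection of the `k`-th cosine (sine) is
`sinc x` times its interpolant at the midpoints of the elements (`projL2_cosL2`, `projL2_sinL2`). The
first `n` interpolants form orthogonal bases (`inner_gridVec`), and all higher frequencies are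
aliased to them. Collecting aliases, `Q H⁻¹` maps the `k`-th discrete cosine to the multiple
`D = ∑_{m ≥ 0} sin² x (1/(x+mπ)² - 1/((m+1)π-x)²)` of the `k`-th discrete sine
(`projL2_hilbTInv_cosVec`). The terms are nonnegative, and the first is `sinc² x (1 - x²/(π-x)²)`.
As `sinc x ≥ 2/π`, the frequencies up to the cutoff give the lower bound
`stabConst * ‖v‖ ≤ ‖Q H⁻¹ v‖` (`stabConst_mul_norm_le`), and the cutoff is below `n` because
`4/π² > 3/π²`. Unique solvability and the first estimate follow, together with the approximation
property `‖u - Q u‖ ≤ h^s ‖u‖_{H^s}` (`norm_sub_projL2_le`), which is obtained by bounding the variance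
of `u` on each element by the double integral of `|u(x) - u(y)|²`.

For the second estimate, `D ≥ 2/(π² n)` costs one power of `h` (`norm_le_mul_norm_discreteOp`), so
that `‖Q H⁻¹ (u - Q u)‖` has to be of order `h²`. If `∂ₜu(0) = 0`, then after subtraction of the
constant `u(T)` the cosine coefficients of `u` are those of `-∂ₜ²u` divided by the squared
frequencies (`exists_cosCoeff_sub_eq`). On the frequencies below `n` one has `0 ≤ 1 - D ≤ 2 x²`
(`one_sub_symbol_le`), and the remaining part `q` of `u` satisfies `‖Q q‖ ≤ ‖H⁻¹ q‖ ≤ h² ‖∂ₜ²u‖`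
(`norm_discreteOp_sub_projL2_le`). The first of these inequalities is Parseval's identity for
piecewise constant functions, which comes from the Fourier series of a Bernoulli polynomial.
-/

noncomputable section

namespace ModHilbert

/-! ### Series along orthogonal families -/

section Orthogonal

variable {E : Type*} [NormedAddCommGroup E] [InnerProductSpace ℝ E]

/-- The family `e` is orthogonal, all its members having the squared norm `a`. -/
def IsOrth (a : ℝ) (e : ℕ → E) : Prop :=
  ∀ k l, inner ℝ (e k) (e l) = if k = l then a else 0

/-- Bessel's inequality. -/
theorem IsOrth.bessel {a : ℝ} {e : ℕ → E} (ha : 0 < a) (he : IsOrth a e) (v : E)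
    (s : Finset ℕ) : ∑ k ∈ s, a⁻¹ * inner ℝ (e k) v ^ 2 ≤ ‖v‖ ^ 2 := by
  have h1 : Orthonormal ℝ fun k => (Real.sqrt a)⁻¹ • e k := by
    rw [orthonormal_iff_ite]
    intro k l
    rw [real_inner_smul_left, real_inner_smul_right, he]
    have h : Real.sqrt a * Real.sqrt a = a := Real.mul_self_sqrt ha.le
    have h0 : Real.sqrt a ≠ 0 := (Real.sqrt_pos.2 ha).ne'
    split_ifs
    · field_simp
      nlinarith
    · simp
  refine le_trans (le_of_eq ?_) (h1.sum_inner_products_le v (s := s))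
  refine Finset.sum_congr rfl fun k _ => ?_
  rw [real_inner_smul_left, Real.norm_eq_abs, sq_abs, mul_pow, inv_pow, Real.sq_sqrt ha.le]

variable [CompleteSpace E]

/-- The expansion of `v` along the orthogonal family `e`, with `e` replaced by `f`. -/
def crossExp (a : ℝ) (e f : ℕ → E) (v : E) : E := ∑' k, (a⁻¹ * inner ℝ (e k) v) • f k

variable {a : ℝ} {e f : ℕ → E}

theorem hasSum_crossExp (ha : 0 < a) (he : IsOrth a e) (hf : IsOrth a f) (v : E) :
    HasSum (fun k => (a⁻¹ * inner ℝ (e k) v) • f k) (crossExp a e f v) := by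
  refine Summable.hasSum ?_
  refine ((summable_of_orthogonal a ha e f he hf v).const_smul a⁻¹).congr fun k => ?_
  rw [smul_smul]

theorem hasSum_inner_crossExp (ha : 0 < a) (he : IsOrth a e) (hf : IsOrth a f) (v w : E) :
    HasSum (fun k => a⁻¹ * inner ℝ (e k) v * inner ℝ (f k) w)
      (inner ℝ (crossExp a e f v) w) := by
  have h := (hasSum_crossExp ha he hf v).mapL (innerSL ℝ w)
  simp only [innerSL_apply_apply, real_inner_smul_right] at h
  rw [real_inner_comm]
  refine h.congr_fun ?_
  intro k
  rw [real_inner_comm w]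

theorem inner_crossExp (ha : 0 < a) (he : IsOrth a e) (hf : IsOrth a f) (v : E) (l : ℕ) :
    inner ℝ (f l) (crossExp a e f v) = inner ℝ (e l) v := by
  rw [real_inner_comm]
  refine (hasSum_inner_crossExp ha he hf v (f l)).unique ?_
  convert hasSum_single l ?_ using 1
  · rw [hf, if_pos rfl]
    field_simp
  · intro k hk
    rw [hf, if_neg hk, mul_zero]

theorem hasSum_norm_crossExp_sq (ha : 0 < a) (he : IsOrth a e) (hf : IsOrth a f) (v : E) :
    HasSum (fun k => a⁻¹ * inner ℝ (e k) v ^ 2) (‖crossExp a e f v‖ ^ 2) := by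
  have h := hasSum_inner_crossExp ha he hf v (crossExp a e f v)
  rw [real_inner_self_eq_norm_sq] at h
  refine h.congr_fun fun k => ?_
  rw [inner_crossExp ha he hf]
  ring

theorem norm_crossExp_le (ha : 0 < a) (he : IsOrth a e) (hf : IsOrth a f) (v : E) :
    ‖crossExp a e f v‖ ≤ ‖v‖ := by
  refine le_of_sq_le_sq ?_ (norm_nonneg _)
  exact hasSum_le_of_sum_le (hasSum_norm_crossExp_sq ha he hf v) fun s => he.bessel ha v s

/-- Exchanging `e` and `f` gives the adjoint. -/
theorem inner_crossExp_left (ha : 0 < a) (he : IsOrth a e) (hf : IsOrth a f) (v w : E) :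
    inner ℝ (crossExp a e f v) w = inner ℝ v (crossExp a f e w) := by
  rw [real_inner_comm (crossExp a f e w)]
  refine (hasSum_inner_crossExp ha he hf v w).unique ?_
  refine (hasSum_inner_crossExp ha hf he w v).congr_fun fun k => ?_
  ring

theorem crossExp_add (ha : 0 < a) (he : IsOrth a e) (hf : IsOrth a f) (v w : E) :
    crossExp a e f (v + w) = crossExp a e f v + crossExp a e f w := by
  refine (hasSum_crossExp ha he hf _).unique ?_
  refine ((hasSum_crossExp ha he hf v).add (hasSum_crossExp ha he hf w)).congr_fun fun k => ?_
  rw [inner_add_right, mul_add, add_smul]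

theorem crossExp_smul (ha : 0 < a) (he : IsOrth a e) (hf : IsOrth a f) (c : ℝ) (v : E) :
    crossExp a e f (c • v) = c • crossExp a e f v := by
  refine (hasSum_crossExp ha he hf _).unique ?_
  refine ((hasSum_crossExp ha he hf v).const_smul c).congr_fun fun k => ?_
  rw [real_inner_smul_right, smul_smul]
  congr 1
  ring

/-- If Parseval's identity holds for `v`, then `v` is recovered from its expansion: `crossExp`
with `e` and `f` exchanged is the adjoint, and both maps are contractions. -/
theorem crossExp_crossExp_of_norm_eq (ha : 0 < a) (he : IsOrth a e) (hf : IsOrth a f) (v : E)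
    (hv : ‖crossExp a e f v‖ = ‖v‖) : crossExp a f e (crossExp a e f v) = v := by
  have h1 := norm_sub_sq_real v (crossExp a f e (crossExp a e f v))
  rw [← inner_crossExp_left ha he hf, real_inner_self_eq_norm_sq, hv] at h1
  have h2 := norm_crossExp_le ha hf he (crossExp a e f v)
  rw [hv] at h2
  have h3 := pow_le_pow_left₀ (norm_nonneg _) h2 2
  have h4 : ‖v - crossExp a f e (crossExp a e f v)‖ ^ 2 = 0 :=
    le_antisymm (by linarith) (sq_nonneg _)
  rw [sq_eq_zero_iff, norm_eq_zero, sub_eq_zero] at h4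
  exact h4.symm

end Orthogonal

variable {T : ℝ} {n : ℕ}

/-! ### The transformation and its inverse -/

theorem isOrth_sinL2 (hT : 0 < T) : IsOrth (T / 2) (sinL2 T) := fun k l => (inner_trig T hT k l).1

theorem isOrth_cosL2 (hT : 0 < T) : IsOrth (T / 2) (cosL2 T) := fun k l => (inner_trig T hT k l).2

theorem sinCoeff_eq (v : L2 T) (k : ℕ) : sinCoeff T v k = (T / 2)⁻¹ * inner ℝ (sinL2 T k) v := by
  rw [sinCoeff, inner_sinL2_left, inv_div]

theorem cosCoeff_eq (v : L2 T) (k : ℕ) : cosCoeff T v k = (T / 2)⁻¹ * inner ℝ (cosL2 T k) v := by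
  rw [cosCoeff, inner_cosL2_left, inv_div]

theorem hilbT_eq (v : L2 T) : hilbT T v = crossExp (T / 2) (sinL2 T) (cosL2 T) v := by
  simp only [hilbT, crossExp, sinCoeff_eq]

theorem hilbTInv_eq (v : L2 T) : hilbTInv T v = crossExp (T / 2) (cosL2 T) (sinL2 T) v := by
  simp only [hilbTInv, crossExp, cosCoeff_eq]

theorem hasSum_hilbTInv (hT : 0 < T) (v : L2 T) :
    HasSum (fun k => cosCoeff T v k • sinL2 T k) (hilbTInv T v) :=
  (summable_hilbTInv T hT v).hasSum

/-- `hilbTInv` as a linear map. -/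
def hilbTInvLin (hT : 0 < T) : L2 T →ₗ[ℝ] L2 T where
  toFun := hilbTInv T
  map_add' v w := by
    simp only [hilbTInv_eq]
    exact crossExp_add (half_pos hT) (isOrth_cosL2 hT) (isOrth_sinL2 hT) v w
  map_smul' c v := by
    simp only [hilbTInv_eq]
    exact crossExp_smul (half_pos hT) (isOrth_cosL2 hT) (isOrth_sinL2 hT) c v

theorem norm_hilbTInv_le (hT : 0 < T) (v : L2 T) : ‖hilbTInv T v‖ ≤ ‖v‖ := by
  rw [hilbTInv_eq]
  exact norm_crossExp_le (half_pos hT) (isOrth_cosL2 hT) (isOrth_sinL2 hT) v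

theorem hasSum_norm_hilbTInv_sq (hT : 0 < T) (v : L2 T) :
    HasSum (fun k => T / 2 * cosCoeff T v k ^ 2) (‖hilbTInv T v‖ ^ 2) := by
  rw [hilbTInv_eq]
  refine (hasSum_norm_crossExp_sq (half_pos hT) (isOrth_cosL2 hT) (isOrth_sinL2 hT) v).congr_fun
    fun k => ?_
  rw [cosCoeff_eq]
  field_simp

/-- The modified Hilbert transformation is the adjoint of its inverse. -/
theorem inner_hilbTInv_left (hT : 0 < T) (v w : L2 T) :
    inner ℝ (hilbTInv T v) w = inner ℝ v (hilbT T w) := by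
  rw [hilbTInv_eq, hilbT_eq]
  exact inner_crossExp_left (half_pos hT) (isOrth_cosL2 hT) (isOrth_sinL2 hT) v w

theorem hilbTInv_cosL2 (hT : 0 < T) (k : ℕ) : hilbTInv T (cosL2 T k) = sinL2 T k := by
  refine (hasSum_hilbTInv hT _).unique ?_
  convert hasSum_single k ?_ using 1
  · rw [cosCoeff_eq, isOrth_cosL2 hT, if_pos rfl, inv_mul_cancel₀ (half_pos hT).ne', one_smul]
  · intro l hl
    rw [cosCoeff_eq, isOrth_cosL2 hT, if_neg hl, mul_zero, zero_smul]

theorem sum_cosCoeff_sq_le (hT : 0 < T) (v : L2 T) (s : Finset ℕ) :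
    ∑ k ∈ s, T / 2 * cosCoeff T v k ^ 2 ≤ ‖v‖ ^ 2 := by
  refine le_trans (le_of_eq ?_) ((isOrth_cosL2 hT).bessel (half_pos hT) v s)
  refine Finset.sum_congr rfl fun k _ => ?_
  rw [cosCoeff_eq]
  field_simp

/-- The angle `(2k+1)π/(4n)`, half the product of the frequency `freq T k` with the mesh
width. -/
def angle (n k : ℕ) : ℝ := (2 * k + 1) * Real.pi / (4 * n)

theorem angle_pos (hn : 0 < n) (k : ℕ) : 0 < angle n k := by
  have : (0 : ℝ) < n := by exact_mod_cast hn
  unfold angle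
  positivity

theorem angle_lt (hn : 0 < n) {k : ℕ} (hk : k < n) :
    angle n k + Real.pi / (4 * n) ≤ Real.pi / 2 := by
  have h1 : (0 : ℝ) < n := by exact_mod_cast hn
  have h2 : (k : ℝ) + 1 ≤ n := by exact_mod_cast hk
  have h3 := Real.pi_pos
  unfold angle
  rw [← add_div, div_le_div_iff₀ (by positivity) (by positivity)]
  nlinarith [mul_le_mul_of_nonneg_left h2 h3.le]

theorem angle_lt_pi_div_two (hn : 0 < n) {k : ℕ} (hk : k < n) : angle n k < Real.pi / 2 := by
  have h1 : (0 : ℝ) < n := by exact_mod_cast hn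
  have := angle_lt hn hk
  have : 0 < Real.pi / (4 * n) := by have := Real.pi_pos; positivity
  linarith

theorem freq_mul (hT : 0 < T) (hn : 0 < n) (k : ℕ) : freq T k * (T / n) = 2 * angle n k := by
  have h1 : (0 : ℝ) < n := by exact_mod_cast hn
  unfold freq angle
  field_simp
  ring

theorem freq_pos (hT : 0 < T) (k : ℕ) : 0 < freq T k := by
  have := Real.pi_pos
  unfold freq
  positivity

theorem angle_add (hn : 0 < n) (m r : ℕ) : angle n (m * (2 * n) + r) = angle n r + m * Real.pi := by
  have h1 : (0 : ℝ) < n := by exact_mod_cast hn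
  unfold angle
  push_cast
  field_simp
  ring

theorem angle_reflect (hn : 0 < n) (m : ℕ) {r : ℕ} (hr : r < n) :
    angle n (m * (2 * n) + (2 * n - 1 - r)) = ((m + 1 : ℕ) : ℝ) * Real.pi - angle n r := by
  have h1 : (0 : ℝ) < n := by exact_mod_cast hn
  have h2 : ((2 * n - 1 - r : ℕ) : ℝ) = 2 * n - 1 - r := by
    rw [Nat.sub_sub, Nat.cast_sub (by omega)]
    push_cast
    ring
  unfold angle
  push_cast [h2]
  field_simp
  ring

/-! ### Grid vectors -/

/-- The piecewise constant interpolant at the element midpoints of `cos(freq T k * t)`. -/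
def cosVec (T : ℝ) (n k : ℕ) : L2 T :=
  ∑ i : Fin n, Real.cos ((2 * i + 1 : ℕ) * angle n k) • basisFn T n i

/-- The piecewise constant interpolant at the element midpoints of `sin(freq T k * t)`. -/
def sinVec (T : ℝ) (n k : ℕ) : L2 T :=
  ∑ i : Fin n, Real.sin ((2 * i + 1 : ℕ) * angle n k) • basisFn T n i

theorem basisFn_mem (i : Fin n) : basisFn T n i ∈ pwConst T n :=
  Submodule.subset_span ⟨i, rfl⟩

theorem cosVec_mem (k : ℕ) : cosVec T n k ∈ pwConst T n :=
  Submodule.sum_mem _ fun i _ => Submodule.smul_mem _ _ (basisFn_mem i)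

theorem sinVec_mem (k : ℕ) : sinVec T n k ∈ pwConst T n :=
  Submodule.sum_mem _ fun i _ => Submodule.smul_mem _ _ (basisFn_mem i)

theorem neg_one_pow_mul_odd (m i : ℕ) : (-1 : ℝ) ^ (m * (2 * i + 1)) = (-1) ^ m := by
  rw [mul_add, mul_one, pow_add, ← mul_assoc, mul_comm m 2, mul_assoc, pow_mul]
  simp

/-- Aliasing: frequencies that differ by a multiple of `2n` agree on the grid up to the sign. -/
theorem cosVec_add (hn : 0 < n) (m r : ℕ) :
    cosVec T n (m * (2 * n) + r) = (-1 : ℝ) ^ m • cosVec T n r := by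
  simp only [cosVec, Finset.smul_sum, smul_smul]
  refine Finset.sum_congr rfl fun i _ => ?_
  congr 1
  rw [angle_add hn, mul_add, ← neg_one_pow_mul_odd m i, ← Real.cos_add_nat_mul_pi]
  congr 1
  push_cast
  ring

theorem sinVec_add (hn : 0 < n) (m r : ℕ) :
    sinVec T n (m * (2 * n) + r) = (-1 : ℝ) ^ m • sinVec T n r := by
  simp only [sinVec, Finset.smul_sum, smul_smul]
  refine Finset.sum_congr rfl fun i _ => ?_
  congr 1
  rw [angle_add hn, mul_add, ← neg_one_pow_mul_odd m i, ← Real.sin_add_nat_mul_pi]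
  congr 1
  push_cast
  ring

/-- Aliasing: frequencies that are symmetric about a multiple of `2n` agree on the grid up to the
sign, which differs for cosines and sines. -/
theorem cosVec_reflect (hn : 0 < n) (m : ℕ) {r : ℕ} (hr : r < n) :
    cosVec T n (m * (2 * n) + (2 * n - 1 - r)) = (-1 : ℝ) ^ (m + 1) • cosVec T n r := by
  simp only [cosVec, Finset.smul_sum, smul_smul]
  refine Finset.sum_congr rfl fun i _ => ?_
  congr 1
  rw [angle_reflect hn m hr, mul_sub, ← neg_one_pow_mul_odd (m + 1) i, ← Real.cos_nat_mul_pi_sub]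
  congr 1
  push_cast
  ring

theorem sinVec_reflect (hn : 0 < n) (m : ℕ) {r : ℕ} (hr : r < n) :
    sinVec T n (m * (2 * n) + (2 * n - 1 - r)) = (-1 : ℝ) ^ m • sinVec T n r := by
  simp only [sinVec, Finset.smul_sum, smul_smul]
  refine Finset.sum_congr rfl fun i _ => ?_
  congr 1
  have h : (-1 : ℝ) ^ m = -(-1) ^ ((m + 1) * (2 * (i : ℕ) + 1)) := by
    rw [neg_one_pow_mul_odd, pow_succ]
    ring
  rw [angle_reflect hn m hr, mul_sub, h, neg_mul, ← Real.sin_nat_mul_pi_sub]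
  congr 1
  push_cast
  ring

theorem sinc_angle_add (hn : 0 < n) (m r : ℕ) :
    Real.sinc (angle n (m * (2 * n) + r)) =
      (-1) ^ m * (Real.sin (angle n r) / (angle n r + m * Real.pi)) := by
  rw [Real.sinc_of_ne_zero (angle_pos hn _).ne', angle_add hn, Real.sin_add_nat_mul_pi,
    mul_div_assoc]

theorem sinc_angle_reflect (hn : 0 < n) (m : ℕ) {r : ℕ} (hr : r < n) :
    Real.sinc (angle n (m * (2 * n) + (2 * n - 1 - r))) =
      (-1) ^ m * (Real.sin (angle n r) / ((m + 1) * Real.pi - angle n r)) := by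
  rw [Real.sinc_of_ne_zero (angle_pos hn _).ne', angle_reflect hn m hr, Real.sin_nat_mul_pi_sub]
  rw [pow_succ]
  push_cast
  ring

/-- The sum telescopes after multiplication by `2 sin y`. -/
theorem sum_cos_odd_mul (n : ℕ) (y : ℝ) :
    2 * Real.sin y * ∑ i ∈ Finset.range n, Real.cos ((2 * i + 1 : ℕ) * y) =
      Real.sin (2 * n * y) := by
  induction n with
  | zero => simp
  | succ n ih =>
    rw [Finset.sum_range_succ, mul_add, ih]
    have h := Real.sin_sub_sin (2 * (n + 1 : ℕ) * y) (2 * n * y)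
    rw [show (2 * (n + 1 : ℕ) * y - 2 * n * y) / 2 = y by push_cast; ring,
      show (2 * (n + 1 : ℕ) * y + 2 * n * y) / 2 = (2 * n + 1 : ℕ) * y by push_cast; ring] at h
    linarith

/-- The midpoint rule integrates the cosines with integer frequencies below `2n` exactly. -/
theorem sum_cos_odd_eq_zero (hn : 0 < n) (m : ℤ) (hm : m ≠ 0) (hmn : |m| < 2 * n) :
    ∑ i ∈ Finset.range n, Real.cos ((2 * i + 1 : ℕ) * (m * Real.pi / (2 * n))) = 0 := by
  have h1 : (0 : ℝ) < n := by exact_mod_cast hn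
  have h := sum_cos_odd_mul n (m * Real.pi / (2 * n))
  rw [show 2 * (n : ℝ) * (m * Real.pi / (2 * n)) = m * Real.pi by field_simp,
    Real.sin_int_mul_pi] at h
  rcases mul_eq_zero.1 h with h0 | h0
  · exfalso
    have h2 : Real.sin (m * Real.pi / (2 * n)) = 0 := by linarith
    obtain ⟨l, hl⟩ := Real.sin_eq_zero_iff.1 h2
    have h3 : (m : ℝ) = l * (2 * n) := by
      have := Real.pi_ne_zero
      field_simp at hl
      linarith
    have h4 : m = l * (2 * n) := by exact_mod_cast h3
    have hl0 : l ≠ 0 := by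
      rintro rfl
      simp at h4
      exact hm h4
    have h5 : 1 ≤ |l| := Int.one_le_abs hl0
    rw [h4, abs_mul, abs_of_nonneg (by positivity : (0 : ℤ) ≤ 2 * n)] at hmn
    nlinarith
  · exact h0

theorem elem_subset (hT : 0 < T) (i : Fin n) :
    Ioo ((i : ℝ) * (T / n)) (((i : ℝ) + 1) * (T / n)) ⊆ Ioo 0 T := by
  have h0 : (0 : ℝ) < n := by exact_mod_cast i.pos
  have h1 : (i : ℝ) + 1 ≤ n := by exact_mod_cast i.2
  refine Ioo_subset_Ioo (by positivity) ?_
  calc ((i : ℝ) + 1) * (T / n) ≤ n * (T / n) := by gcongr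
    _ = T := by field_simp

theorem inner_basisFn (hT : 0 < T) (i : Fin n) (v : L2 T) :
    inner ℝ (basisFn T n i) v = ∫ t in Ioo ((i : ℝ) * (T / n)) (((i : ℝ) + 1) * (T / n)), v t := by
  rw [basisFn, L2.inner_indicatorConstLp_one, Measure.restrict_restrict measurableSet_Ioo,
    inter_eq_left.2 (elem_subset hT i)]

theorem inner_basisFn_basisFn (hT : 0 < T) (i j : Fin n) :
    inner ℝ (basisFn T n i) (basisFn T n j) = if i = j then T / n else 0 := by
  have h0 : (0 : ℝ) < n := by exact_mod_cast i.pos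
  rw [basisFn, basisFn, L2.inner_indicatorConstLp_one,
    integral_congr_ae (ae_restrict_of_ae indicatorConstLp_coeFn),
    integral_indicator_const _ measurableSet_Ioo, Measure.real,
    Measure.restrict_apply measurableSet_Ioo, Measure.restrict_apply
      (measurableSet_Ioo.inter measurableSet_Ioo)]
  split_ifs with h
  · subst h
    rw [inter_self, inter_eq_left.2 (elem_subset hT i), Real.volume_Ioo,
      ENNReal.toReal_ofReal (by rw [← sub_mul]; simp; positivity)]
    simp
    ring
  · rw [Ioo_inter_Ioo, Ioo_eq_empty]
    · simp
    · rw [not_lt]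
      have hp : 0 < T / n := by positivity
      rcases lt_or_gt_of_ne h with h | h
      · have h1 : (i : ℝ) + 1 ≤ j := by exact_mod_cast h
        exact (inf_le_right).trans ((mul_le_mul_of_nonneg_right h1 hp.le).trans le_sup_left)
      · have h1 : (j : ℝ) + 1 ≤ i := by exact_mod_cast h
        exact (inf_le_left).trans ((mul_le_mul_of_nonneg_right h1 hp.le).trans le_sup_right)

theorem inner_basisFn_sum (hT : 0 < T) (i : Fin n) (c : Fin n → ℝ) :
    inner ℝ (basisFn T n i) (∑ j, c j • basisFn T n j) = T / n * c i := by
  simp_rw [inner_sum, real_inner_smul_right, inner_basisFn_basisFn hT]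
  simp
  ring

theorem inner_sum_sum (hT : 0 < T) (c d : Fin n → ℝ) :
    inner ℝ (∑ j, c j • basisFn T n j) (∑ j, d j • basisFn T n j) = T / n * ∑ i, c i * d i := by
  simp_rw [sum_inner, real_inner_smul_left, inner_basisFn_sum hT, Finset.mul_sum]
  refine Finset.sum_congr rfl fun i _ => by ring

/-- Orthogonality of the discrete cosine and sine bases (the transforms of type IV). -/
theorem inner_gridVec (hT : 0 < T) {k l : ℕ} (hk : k < n) (hl : l < n) :
    inner ℝ (cosVec T n k) (cosVec T n l) = (if k = l then T / 2 else 0) ∧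
    inner ℝ (sinVec T n k) (sinVec T n l) = if k = l then T / 2 else 0 := by
  have hn : 0 < n := by omega
  have h0 : (0 : ℝ) < n := by exact_mod_cast hn
  have hI : ∀ m : ℤ, |m| < 2 * n →
      ∑ i : Fin n, Real.cos ((2 * i + 1 : ℕ) * (m * Real.pi / (2 * n))) =
      if m = 0 then (n : ℝ) else 0 := by
    intro m hm
    split_ifs with h
    · simp [h]
    · rw [← sum_cos_odd_eq_zero hn m h hm, ← Fin.sum_univ_eq_sum_range
        (fun i => Real.cos ((2 * i + 1 : ℕ) * (m * Real.pi / (2 * n))))]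
  have hd := hI ((k : ℤ) - l) (by rw [abs_lt]; omega)
  have hs := hI ((k : ℤ) + l + 1) (by rw [abs_lt]; omega)
  rw [if_neg (by omega)] at hs
  have e1 : (if (k : ℤ) - l = 0 then (n : ℝ) else 0) = if k = l then (n : ℝ) else 0 := by
    congr 1
    simp [sub_eq_zero]
  rw [e1] at hd
  have ad : ∀ i : Fin n, ((2 * i + 1 : ℕ) : ℝ) * (((k : ℤ) - l : ℤ) * Real.pi / (2 * n)) =
      (2 * i + 1 : ℕ) * angle n k - (2 * i + 1 : ℕ) * angle n l := by
    intro i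
    unfold angle
    push_cast
    field_simp
    ring
  have as : ∀ i : Fin n, ((2 * i + 1 : ℕ) : ℝ) * (((k : ℤ) + l + 1 : ℤ) * Real.pi / (2 * n)) =
      (2 * i + 1 : ℕ) * angle n k + (2 * i + 1 : ℕ) * angle n l := by
    intro i
    unfold angle
    push_cast
    field_simp
    ring
  simp_rw [ad, Real.cos_sub] at hd
  simp_rw [as, Real.cos_add] at hs
  rw [Finset.sum_add_distrib] at hd
  rw [Finset.sum_sub_distrib] at hs
  constructor
  · rw [cosVec, cosVec, inner_sum_sum hT]
    split_ifs at hd ⊢ with h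
    · field_simp
      linarith
    · rw [mul_eq_zero]; right; linarith
  · rw [sinVec, sinVec, inner_sum_sum hT]
    split_ifs at hd ⊢ with h
    · field_simp
      linarith
    · rw [mul_eq_zero]; right; linarith

/-! ### The projection of the trigonometric functions -/

theorem projL2_mem (u : L2 T) : projL2 T n u ∈ pwConst T n :=
  Submodule.starProjection_apply_mem _ _

theorem inner_projL2_left {v : L2 T} (hv : v ∈ pwConst T n) (u : L2 T) :
    inner ℝ (projL2 T n u) v = inner ℝ u v := by
  rw [projL2, Submodule.inner_starProjection_left_eq_right,
    Submodule.starProjection_eq_self_iff.2 hv]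

theorem projL2_eq_of_inner {u w : L2 T} (hw : w ∈ pwConst T n)
    (h : ∀ i, inner ℝ (basisFn T n i) w = inner ℝ (basisFn T n i) u) : projL2 T n u = w := by
  refine Submodule.eq_starProjection_of_mem_of_inner_eq_zero hw fun v hv => ?_
  rw [real_inner_comm]
  induction hv using Submodule.span_induction with
  | mem x hx =>
    obtain ⟨i, rfl⟩ := hx
    rw [inner_sub_right, h, sub_self]
  | zero => simp
  | add x y _ _ hx hy => rw [inner_add_left, hx, hy, add_zero]
  | smul a x _ hx => rw [real_inner_smul_left, hx, mul_zero]

theorem inner_basisFn_trig (hT : 0 < T) (i : Fin n) (k : ℕ) :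
    inner ℝ (basisFn T n i) (cosL2 T k) =
      T / n * (Real.sinc (angle n k) * Real.cos ((2 * i + 1 : ℕ) * angle n k)) ∧
    inner ℝ (basisFn T n i) (sinL2 T k) =
      T / n * (Real.sinc (angle n k) * Real.sin ((2 * i + 1 : ℕ) * angle n k)) := by
  have h0 : (0 : ℝ) < n := by exact_mod_cast i.pos
  have hw := (freq_pos hT k).ne'
  have hx := (angle_pos i.pos k).ne'
  have hf := freq_mul hT i.pos k
  have hle : (i : ℝ) * (T / n) ≤ (i + 1) * (T / n) := by
    have : 0 < T / n := by positivity
    nlinarith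
  have e1 : freq T k * ((i : ℝ) * (T / n)) = (2 * i + 1 : ℕ) * angle n k - angle n k := by
    push_cast
    linear_combination (i : ℝ) * hf
  have e2 : freq T k * (((i : ℝ) + 1) * (T / n)) = (2 * i + 1 : ℕ) * angle n k + angle n k := by
    push_cast
    linear_combination ((i : ℝ) + 1) * hf
  have e3 : T / n = 2 * angle n k / freq T k := by
    rw [eq_div_iff hw]
    linarith
  have ae1 := (ae_restrict_of_ae_restrict_of_subset (elem_subset hT i)
    (memLp_cos T k).coeFn_toLp)
  have ae2 := (ae_restrict_of_ae_restrict_of_subset (elem_subset hT i)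
    (memLp_sin T k).coeFn_toLp)
  constructor
  · rw [inner_basisFn hT, cosL2, integral_congr_ae ae1, ← integral_Ioc_eq_integral_Ioo,
      ← intervalIntegral.integral_of_le hle,
      intervalIntegral.integral_comp_mul_left (fun x => Real.cos x) hw, integral_cos, e1, e2,
      Real.sin_add, Real.sin_sub, Real.sinc_of_ne_zero hx, e3, smul_eq_mul]
    field_simp
    ring
  · rw [inner_basisFn hT, sinL2, integral_congr_ae ae2, ← integral_Ioc_eq_integral_Ioo,
      ← intervalIntegral.integral_of_le hle,
      intervalIntegral.integral_comp_mul_left (fun x => Real.sin x) hw, integral_sin, e1, e2,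
      Real.cos_add, Real.cos_sub, Real.sinc_of_ne_zero hx, e3, smul_eq_mul]
    field_simp
    ring

theorem projL2_cosL2 (hT : 0 < T) (k : ℕ) :
    projL2 T n (cosL2 T k) = Real.sinc (angle n k) • cosVec T n k := by
  refine projL2_eq_of_inner (Submodule.smul_mem _ _ (cosVec_mem k)) fun i => ?_
  rw [real_inner_smul_right, cosVec, inner_basisFn_sum hT, (inner_basisFn_trig hT i k).1]
  ring

theorem projL2_sinL2 (hT : 0 < T) (k : ℕ) :
    projL2 T n (sinL2 T k) = Real.sinc (angle n k) • sinVec T n k := by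
  refine projL2_eq_of_inner (Submodule.smul_mem _ _ (sinVec_mem k)) fun i => ?_
  rw [real_inner_smul_right, sinVec, inner_basisFn_sum hT, (inner_basisFn_trig hT i k).2]
  ring

/-! ### The symbol of the discrete operator -/

/-- The `m`-th pair of aliasing contributions to the symbol at the angle `x`: the frequencies
`x + mπ` and `(m+1)π - x` agree on the grid, up to the sign. -/
def symbolTerm (x : ℝ) (m : ℕ) : ℝ :=
  (Real.sin x / (x + m * Real.pi)) ^ 2 - (Real.sin x / ((m + 1) * Real.pi - x)) ^ 2

/-- The factor by which the discrete operator `v ↦ projL2 (hilbTInv v)` on piecewise constants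
multiplies the mode `k`, see `projL2_hilbTInv_cosVec`. -/
def symbol (n k : ℕ) : ℝ := ∑' m, symbolTerm (angle n k) m

/-- The lower bound `1 - x²/(π-x)²` for the symbol, relative to `sinc² x`. -/
def symbolBound (x : ℝ) : ℝ := 1 - (x / (Real.pi - x)) ^ 2

theorem symbolTerm_nonneg {x : ℝ} (hx : 0 < x) (hx' : x < Real.pi / 2) (m : ℕ) :
    0 ≤ symbolTerm x m := by
  have h1 : 0 < Real.sin x := Real.sin_pos_of_pos_of_lt_pi hx (by linarith)
  have h2 : (0 : ℝ) ≤ m * Real.pi := by have := Real.pi_pos; positivity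
  have h3 : x + m * Real.pi ≤ (m + 1) * Real.pi - x := by linarith
  rw [symbolTerm, sub_nonneg]
  have h4 : 0 < (m + 1) * Real.pi - x := by linarith
  gcongr

theorem symbolTerm_zero {x : ℝ} (hx : x ≠ 0) :
    symbolTerm x 0 = Real.sinc x ^ 2 * symbolBound x := by
  rw [symbolTerm, symbolBound, Real.sinc_of_ne_zero hx]
  simp only [Nat.cast_zero, zero_mul, add_zero, zero_add, one_mul]
  rw [mul_sub, mul_one, ← mul_pow, div_mul_div_cancel₀ hx]

theorem norm_projL2_le (u : L2 T) : ‖projL2 T n u‖ ≤ ‖u‖ :=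
  Submodule.norm_starProjection_apply_le _ _

/-- The coefficient of `v` with respect to the discrete cosine basis. -/
def gridCoeff (T : ℝ) (n : ℕ) (v : L2 T) (k : ℕ) : ℝ := (T / 2)⁻¹ * inner ℝ (cosVec T n k) v

/-- The cosine coefficients of a piecewise constant function are damped samples of its grid
coefficients; beyond the index `n` the latter repeat up to the sign. -/
theorem cosCoeff_of_mem (hT : 0 < T) {v : L2 T} (hv : v ∈ pwConst T n) (j : ℕ) :
    cosCoeff T v j = Real.sinc (angle n j) * gridCoeff T n v j := by
  rw [gridCoeff, cosCoeff_eq, ← inner_projL2_left hv, projL2_cosL2 hT, real_inner_smul_left]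
  ring

/-- Only the frequencies aliased to `k` contribute to the image of `cosVec T n k`; they are paired
by regrouping the series into blocks of length `2n`. -/
theorem hasSum_symbolTerm_smul (hT : 0 < T) {k : ℕ} (hk : k < n) :
    HasSum (fun m => symbolTerm (angle n k) m • sinVec T n k)
      (projL2 T n (hilbTInv T (cosVec T n k))) := by
  have hn : 0 < n := by omega
  set V : ℕ → L2 T := fun j => (Real.sinc (angle n j) ^ 2 *
    ((T / 2)⁻¹ * inner ℝ (cosVec T n j) (cosVec T n k))) • sinVec T n j with hV
  have h1 : HasSum V (projL2 T n (hilbTInv T (cosVec T n k))) := by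
    refine ((hasSum_hilbTInv hT (cosVec T n k)).mapL (pwConst T n).starProjection).congr_fun
      fun j => ?_
    rw [map_smul]
    change V j = _ • projL2 T n (sinL2 T j)
    rw [projL2_sinL2 hT, cosCoeff_of_mem hT (cosVec_mem k), smul_smul, gridCoeff]
    simp only [hV]
    congr 1
    ring
  have key : ∀ m, ∑ r ∈ Finset.range (2 * n), V (m * (2 * n) + r) =
      symbolTerm (angle n k) m • sinVec T n k := by
    intro m
    have hs : ((-1 : ℝ) ^ m) ^ 2 = 1 := by rw [← pow_mul, mul_comm, pow_mul]; simp
    rw [two_mul n, Finset.sum_range_add, ← two_mul,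
      ← Finset.sum_range_reflect (fun r => V (m * (2 * n) + (n + r))), ← Finset.sum_add_distrib,
      Finset.sum_eq_single k]
    · rw [show n + (n - 1 - k) = 2 * n - 1 - k by omega]
      simp only [hV]
      rw [cosVec_add hn, cosVec_reflect hn m hk, sinVec_add hn, sinVec_reflect hn m hk,
        sinc_angle_add hn, sinc_angle_reflect hn m hk, real_inner_smul_left,
        real_inner_smul_left, (inner_gridVec hT hk hk).1, if_pos rfl, smul_smul, smul_smul,
        ← add_smul]
      congr 1
      have hT2 : ∀ c : ℝ, (T / 2)⁻¹ * (c * (T / 2)) = c := fun c => by field_simp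
      rw [symbolTerm, mul_pow, mul_pow, hs, hT2, hT2, pow_succ]
      linear_combination ((Real.sin (angle n k) / (angle n k + m * Real.pi)) ^ 2 -
        (Real.sin (angle n k) / ((m + 1) * Real.pi - angle n k)) ^ 2) * hs
    · intro r hr hrk
      have hr := Finset.mem_range.1 hr
      rw [show n + (n - 1 - r) = 2 * n - 1 - r by omega]
      simp only [hV]
      rw [cosVec_add hn, cosVec_reflect hn m hr, real_inner_smul_left,
        real_inner_smul_left, (inner_gridVec hT hr hk).1, if_neg hrk]
      simp
    · intro h
      exact absurd (Finset.mem_range.2 hk) h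
  have : NeZero (2 * n) := ⟨by omega⟩
  have h2 := ((Nat.divModEquiv (2 * n)).symm.hasSum_iff.2 h1).prod_fiberwise
    (fun m => hasSum_fintype _)
  refine h2.congr_fun fun m => ?_
  rw [← key, ← Fin.sum_univ_eq_sum_range (fun r => V (m * (2 * n) + r))]
  rfl

theorem inner_sinVec_self (hT : 0 < T) {k : ℕ} (hk : k < n) :
    inner ℝ (sinVec T n k) (sinVec T n k) = T / 2 := by
  rw [(inner_gridVec hT hk hk).2, if_pos rfl]

theorem hasSum_symbol (hT : 0 < T) {k : ℕ} (hk : k < n) :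
    HasSum (symbolTerm (angle n k)) (symbol n k) := by
  refine Summable.hasSum ?_
  have h := ((hasSum_symbolTerm_smul hT hk).mapL (innerSL ℝ (sinVec T n k))).summable
  simp only [innerSL_apply_apply, real_inner_smul_right, inner_sinVec_self hT hk] at h
  exact (summable_mul_right_iff (half_pos hT).ne').1 h

/-- On piecewise constants the projected inverse transformation is diagonal with respect to the
discrete cosine and sine bases. -/
theorem projL2_hilbTInv_cosVec (hT : 0 < T) {k : ℕ} (hk : k < n) :
    projL2 T n (hilbTInv T (cosVec T n k)) = symbol n k • sinVec T n k :=
  (hasSum_symbolTerm_smul hT hk).unique ((hasSum_symbol hT hk).smul_const _)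

/-- All terms of the symbol are nonnegative; the bound is the first one. -/
theorem le_symbol {k : ℕ} (hk : k < n) :
    Real.sinc (angle n k) ^ 2 * symbolBound (angle n k) ≤ symbol n k := by
  have hn : 0 < n := by omega
  rw [← symbolTerm_zero (angle_pos hn k).ne']
  exact le_hasSum (hasSum_symbol one_pos hk) 0 fun m _ =>
    symbolTerm_nonneg (angle_pos hn k) (angle_lt_pi_div_two hn hk) m

/-- The projected inverse transformation is a contraction. -/
theorem symbol_le_one {k : ℕ} (hk : k < n) : symbol n k ≤ 1 := by
  have h1 : ‖symbol n k • sinVec 1 n k‖ ≤ ‖cosVec 1 n k‖ := by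
    rw [← projL2_hilbTInv_cosVec one_pos hk]
    exact (norm_projL2_le _).trans (norm_hilbTInv_le one_pos _)
  have h2 : ‖cosVec 1 n k‖ ^ 2 = 1 / 2 := by
    rw [← real_inner_self_eq_norm_sq, (inner_gridVec one_pos hk hk).1, if_pos rfl]
  have h3 : ‖sinVec 1 n k‖ ^ 2 = 1 / 2 := by
    rw [← real_inner_self_eq_norm_sq, (inner_gridVec one_pos hk hk).2, if_pos rfl]
  have h4 := pow_le_pow_left₀ (norm_nonneg _) h1 2
  rw [norm_smul, mul_pow, h2, h3, Real.norm_eq_abs, sq_abs] at h4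
  nlinarith

theorem two_div_pi_le_sinc {x : ℝ} (hx : 0 < x) (hx' : x ≤ Real.pi / 2) :
    2 / Real.pi ≤ Real.sinc x := by
  rw [Real.sinc_of_ne_zero hx.ne', le_div_iff₀ hx]
  exact Real.mul_le_sin hx.le hx'

theorem symbolBound_anti {x y : ℝ} (hx : 0 ≤ x) (hxy : x ≤ y) (hy : y < Real.pi) :
    symbolBound y ≤ symbolBound x := by
  have h1 : 0 < Real.pi - y := by linarith
  have h2 : 0 < Real.pi - x := by linarith
  have h3 : 0 ≤ y := hx.trans hxy
  unfold symbolBound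
  gcongr

theorem symbolBound_pos {x : ℝ} (hx : 0 ≤ x) (hx' : x < Real.pi / 2) : 0 < symbolBound x := by
  have h1 : 0 < Real.pi - x := by linarith
  rw [symbolBound, sub_pos]
  refine pow_lt_one₀ (by positivity) ?_ two_ne_zero
  rw [div_lt_one h1]
  linarith

/-- The symbol degenerates at most like `1/n` at the highest frequencies. -/
theorem inv_le_symbol {k : ℕ} (hk : k < n) : 2 / (Real.pi ^ 2 * n) ≤ symbol n k := by
  have hn : 0 < n := by omega
  have h0 : (0 : ℝ) < n := by exact_mod_cast hn
  have hx := angle_pos hn k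
  have hx' := angle_lt hn hk
  have hx'' := angle_lt_pi_div_two hn hk
  have hp := Real.pi_pos
  have h1 := two_div_pi_le_sinc hx hx''.le
  have h2 : 1 / (2 * n : ℝ) ≤ symbolBound (angle n k) := by
    have h3 : 0 < Real.pi - angle n k := by linarith
    have h4 : symbolBound (angle n k) =
        Real.pi * (Real.pi - 2 * angle n k) / (Real.pi - angle n k) ^ 2 := by
      rw [symbolBound]
      field_simp
      ring
    have h5 : Real.pi / (2 * n) ≤ Real.pi - 2 * angle n k := by
      have : Real.pi / (2 * n) = 2 * (Real.pi / (4 * n)) := by field_simp; ring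
      linarith
    calc 1 / (2 * n : ℝ) = Real.pi * (Real.pi / (2 * n)) / Real.pi ^ 2 := by field_simp
      _ ≤ Real.pi * (Real.pi - 2 * angle n k) / (Real.pi - angle n k) ^ 2 := by
        have h6 : 0 ≤ Real.pi / (2 * n) := by positivity
        have h7 := mul_nonneg hp.le (h6.trans h5)
        gcongr
        linarith
      _ = _ := h4.symm
  calc 2 / (Real.pi ^ 2 * n) = (2 / Real.pi) ^ 2 * (1 / (2 * n)) := by field_simp
    _ ≤ Real.sinc (angle n k) ^ 2 * symbolBound (angle n k) := by gcongr
    _ ≤ _ := le_symbol hk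

/-- The discrete operator is consistent of second order in the angle. -/
theorem one_sub_symbol_le {k : ℕ} (hk : k < n) : 1 - symbol n k ≤ 2 * angle n k ^ 2 := by
  have hn : 0 < n := by omega
  have hx := angle_pos hn k
  have hx'' := angle_lt_pi_div_two hn hk
  set x := angle n k
  have hp := Real.pi_gt_three
  have hc : 0 < Real.cos x := Real.cos_pos_of_mem_Ioo ⟨by linarith, hx''⟩
  have h1 : Real.cos x ≤ Real.sinc x := by
    rw [Real.sinc_of_ne_zero hx.ne', le_div_iff₀ hx]
    have := Real.lt_tan hx hx''
    rw [Real.tan_eq_sin_div_cos, lt_div_iff₀ hc] at this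
    linarith
  have h2 : Real.sin x ^ 2 ≤ x ^ 2 := by
    have := Real.sin_le hx.le
    have := Real.sin_nonneg_of_nonneg_of_le_pi hx.le (by linarith)
    gcongr
  have h3 : Real.cos x ^ 2 ≤ Real.sinc x ^ 2 := by gcongr
  have h4 : Real.sinc x ^ 2 ≤ 1 := pow_le_one₀ (hc.le.trans h1) (Real.sinc_le_one x)
  have h5 : (x / (Real.pi - x)) ^ 2 ≤ x ^ 2 := by
    have : x / (Real.pi - x) ≤ x := div_le_self hx.le (by linarith)
    have h6 : 0 < Real.pi - x := by linarith
    gcongr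
  have h6 := le_symbol hk
  rw [symbolBound] at h6
  have h7 := Real.sin_sq_add_cos_sq x
  nlinarith [mul_le_mul h4 h5 (sq_nonneg _) zero_le_one]

/-! ### Stability -/

/-- The `n` discrete cosine vectors are orthogonal in a space of dimension at most `n`. -/
theorem pwConst_eq_span_cosVec (hT : 0 < T) :
    Submodule.span ℝ (range fun k : Fin n => cosVec T n k) = pwConst T n := by
  have hli : LinearIndependent ℝ fun k : Fin n => cosVec T n k := by
    refine linearIndependent_of_ne_zero_of_inner_eq_zero (𝕜 := ℝ) ?_ ?_
    · intro k hk
      have h := (inner_gridVec hT k.2 k.2).1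
      rw [hk, inner_zero_left, if_pos rfl] at h
      linarith
    · intro k l hkl
      rw [(inner_gridVec hT k.2 l.2).1, if_neg (fun h => hkl (Fin.ext h))]
  refine Submodule.eq_of_le_of_finrank_le ?_ ?_
  · rw [Submodule.span_le]
    rintro _ ⟨k, rfl⟩
    exact cosVec_mem _
  · rw [finrank_span_eq_card hli]
    exact finrank_range_le_card _

theorem sum_gridCoeff_smul (hT : 0 < T) {v : L2 T} (hv : v ∈ pwConst T n) :
    ∑ k ∈ Finset.range n, gridCoeff T n v k • cosVec T n k = v := by
  rw [← sub_eq_zero, ← inner_self_eq_zero (𝕜 := ℝ)]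
  set z := ∑ k ∈ Finset.range n, gridCoeff T n v k • cosVec T n k - v with hz
  have hzm : z ∈ pwConst T n :=
    Submodule.sub_mem _ (Submodule.sum_mem _ fun k _ => Submodule.smul_mem _ _ (cosVec_mem k)) hv
  have horth : ∀ l : Fin n, inner ℝ (cosVec T n l) z = 0 := by
    intro l
    rw [hz, inner_sub_right, inner_sum, Finset.sum_eq_single (l : ℕ)]
    · rw [real_inner_smul_right, (inner_gridVec hT l.2 l.2).1, if_pos rfl, gridCoeff]
      field_simp
      ring
    · intro k hk hkl
      rw [real_inner_smul_right, (inner_gridVec hT l.2 (Finset.mem_range.1 hk)).1,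
        if_neg (Ne.symm hkl), mul_zero]
    · intro h
      exact absurd (Finset.mem_range.2 l.2) h
  have : ∀ w ∈ pwConst T n, inner ℝ w z = 0 := by
    intro w hw
    rw [← pwConst_eq_span_cosVec hT] at hw
    induction hw using Submodule.span_induction with
    | mem x hx =>
      obtain ⟨l, rfl⟩ := hx
      exact horth l
    | zero => simp
    | add x y _ _ hx hy => rw [inner_add_left, hx, hy, add_zero]
    | smul a x _ hx => rw [real_inner_smul_left, hx, mul_zero]
  exact this z hzm

theorem norm_sum_smul_sq {E : Type*} [NormedAddCommGroup E] [InnerProductSpace ℝ E] {a : ℝ}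
    {e : ℕ → E} (s : Finset ℕ) (he : ∀ k ∈ s, ∀ l ∈ s, inner ℝ (e k) (e l) = if k = l then a else 0)
    (c : ℕ → ℝ) : ‖∑ k ∈ s, c k • e k‖ ^ 2 = a * ∑ k ∈ s, c k ^ 2 := by
  rw [← real_inner_self_eq_norm_sq, sum_inner, Finset.mul_sum]
  refine Finset.sum_congr rfl fun k hk => ?_
  rw [inner_sum, Finset.sum_eq_single k]
  · rw [real_inner_smul_left, real_inner_smul_right, he k hk k hk, if_pos rfl]
    ring
  · intro l hl hlk
    rw [real_inner_smul_left, real_inner_smul_right, he k hk l hl, if_neg (Ne.symm hlk)]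
    ring
  · intro h
    exact absurd hk h

theorem norm_sum_cosVec_sq (hT : 0 < T) (c : ℕ → ℝ) :
    ‖∑ k ∈ Finset.range n, c k • cosVec T n k‖ ^ 2 = T / 2 * ∑ k ∈ Finset.range n, c k ^ 2 :=
  norm_sum_smul_sq _ (fun _ hk _ hl =>
    (inner_gridVec hT (Finset.mem_range.1 hk) (Finset.mem_range.1 hl)).1) c

theorem norm_sum_sinVec_sq (hT : 0 < T) (c : ℕ → ℝ) :
    ‖∑ k ∈ Finset.range n, c k • sinVec T n k‖ ^ 2 = T / 2 * ∑ k ∈ Finset.range n, c k ^ 2 :=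
  norm_sum_smul_sq _ (fun _ hk _ hl =>
    (inner_gridVec hT (Finset.mem_range.1 hk) (Finset.mem_range.1 hl)).2) c

theorem norm_sq_of_mem (hT : 0 < T) {v : L2 T} (hv : v ∈ pwConst T n) :
    ‖v‖ ^ 2 = T / 2 * ∑ k ∈ Finset.range n, gridCoeff T n v k ^ 2 := by
  rw [← norm_sum_cosVec_sq hT, sum_gridCoeff_smul hT hv]

/-- `v ↦ projL2 (hilbTInv v)` as a linear map. -/
def discreteOp (hT : 0 < T) (n : ℕ) : L2 T →ₗ[ℝ] L2 T :=
  (pwConst T n).starProjection.toLinearMap ∘ₗ hilbTInvLin hT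

theorem discreteOp_apply (hT : 0 < T) (v : L2 T) :
    discreteOp hT n v = projL2 T n (hilbTInv T v) := rfl

/-- The norm of the discrete operator in terms of the symbol. -/
theorem norm_discreteOp_sq (hT : 0 < T) {v : L2 T} (hv : v ∈ pwConst T n) :
    ‖projL2 T n (hilbTInv T v)‖ ^ 2 =
      T / 2 * ∑ k ∈ Finset.range n, (gridCoeff T n v k * symbol n k) ^ 2 := by
  rw [← norm_sum_sinVec_sq hT]
  congr 2
  conv_lhs => rw [← discreteOp_apply hT, ← sum_gridCoeff_smul hT hv, map_sum]
  refine Finset.sum_congr rfl fun k hk => ?_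
  rw [map_smul, discreteOp_apply, projL2_hilbTInv_cosVec hT (Finset.mem_range.1 hk), smul_smul]

/-- A piecewise constant function is resolved, in the sense of `cutoff`, by its first `n`
frequencies: the damping factors `sinc² ≥ 4/π²` exceed `3/π²`. -/
theorem cutoff_spec (hT : 0 < T) (hn : 0 < n) {v : L2 T} (hv : v ∈ pwConst T n) :
    cutoff T v < n ∧ ‖v‖ ^ 2 ≤ T / 2 * (Real.pi ^ 2 / 3) *
      ∑ k ∈ Finset.range (cutoff T v + 1), cosCoeff T v k ^ 2 := by
  set S := {m : ℕ | ‖v‖ ^ 2 ≤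
    T / 2 * (Real.pi ^ 2 / 3) * ∑ k ∈ Finset.range (m + 1), cosCoeff T v k ^ 2} with hS
  have hp := Real.pi_pos
  have hmem : n - 1 ∈ S := by
    rw [hS, mem_ofPred_eq, Nat.sub_add_cancel hn, norm_sq_of_mem hT hv, mul_assoc]
    refine mul_le_mul_of_nonneg_left ?_ (half_pos hT).le
    rw [Finset.mul_sum]
    refine Finset.sum_le_sum fun k hk => ?_
    rw [cosCoeff_of_mem hT hv, mul_pow]
    have h1 := two_div_pi_le_sinc (angle_pos hn k)
      (angle_lt_pi_div_two hn (Finset.mem_range.1 hk)).le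
    have h2 : 1 ≤ Real.pi ^ 2 / 3 * Real.sinc (angle n k) ^ 2 := by
      calc (1 : ℝ) ≤ Real.pi ^ 2 / 3 * (2 / Real.pi) ^ 2 := by field_simp; norm_num
        _ ≤ _ := by gcongr
    nlinarith [sq_nonneg (gridCoeff T n v k)]
  have h1 : cutoff T v ≤ n - 1 := Nat.sInf_le hmem
  exact ⟨by omega, Nat.sInf_mem ⟨_, hmem⟩⟩

theorem stabConst_eq (hn : 0 < n) (v : L2 T) :
    stabConst T n v =
      2 * Real.sqrt 3 / Real.pi ^ 2 * symbolBound (angle n (cutoff T v)) := by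
  have h0 : (0 : ℝ) < n := by exact_mod_cast hn
  have hp := Real.pi_pos
  rw [stabConst, symbolBound, angle]
  congr 1
  set y : ℝ := 2 * (cutoff T v : ℝ) + 1
  have hy : Real.pi - y * Real.pi / (4 * n) = Real.pi * (4 * n - y) / (4 * n) := by
    field_simp
  rw [hy]
  have hne : 4 * (n : ℝ) - y ≠ 0 := by
    -- the two numbers have different parities
    intro h
    have h1 : ((4 * n : ℕ) : ℝ) = (2 * cutoff T v + 1 : ℕ) := by
      push_cast
      linarith
    have h2 : 4 * n = 2 * cutoff T v + 1 := by exact_mod_cast h1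
    omega
  have h3 : y * Real.pi / (4 * n) / (Real.pi * (4 * n - y) / (4 * n)) = y / (4 * n - y) := by
    field_simp
  rw [h3, div_pow, eq_sub_iff_add_eq, ← add_div, div_eq_one_iff_eq (pow_ne_zero 2 hne)]
  ring

theorem stabConst_pos (hT : 0 < T) (hn : 0 < n) {v : L2 T} (hv : v ∈ pwConst T n) :
    0 < stabConst T n v := by
  have hp := Real.pi_pos
  have := symbolBound_pos (angle_pos hn _).le
    (angle_lt_pi_div_two hn (cutoff_spec hT hn hv).1)
  rw [stabConst_eq hn]
  positivity

theorem angle_mono {k l : ℕ} (hkl : k ≤ l) : angle n k ≤ angle n l := by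
  have h : (k : ℝ) ≤ l := by exact_mod_cast hkl
  have hp := Real.pi_pos
  unfold angle
  gcongr

/-- The inf-sup condition with the constant `stabConst`. -/
theorem stabConst_mul_norm_le (hT : 0 < T) (hn : 0 < n) {v : L2 T} (hv : v ∈ pwConst T n) :
    stabConst T n v * ‖v‖ ≤ ‖projL2 T n (hilbTInv T v)‖ := by
  obtain ⟨hM, hMv⟩ := cutoff_spec hT hn hv
  have hp := Real.pi_pos
  have hpos := stabConst_pos hT hn hv
  refine le_of_sq_le_sq ?_ (norm_nonneg _)
  rw [norm_discreteOp_sq hT hv]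
  set M := cutoff T v
  set f := symbolBound (angle n M) with hf
  have hf0 : 0 < f := symbolBound_pos (angle_pos hn _).le (angle_lt_pi_div_two hn hM)
  have hterm : ∀ k ∈ Finset.range (M + 1), (2 / Real.pi * f) ^ 2 * cosCoeff T v k ^ 2 ≤
      (gridCoeff T n v k * symbol n k) ^ 2 := by
    intro k hk
    have hkM : k ≤ M := Nat.lt_succ_iff.1 (Finset.mem_range.1 hk)
    have hkn : k < n := by omega
    have h1 := two_div_pi_le_sinc (angle_pos hn k) (angle_lt_pi_div_two hn hkn).le
    have h0 : 0 < 2 / Real.pi := by positivity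
    have h2 : f ≤ symbolBound (angle n k) :=
      symbolBound_anti (angle_pos hn k).le (angle_mono hkM)
        (by linarith [angle_lt_pi_div_two hn hM])
    have h3 : 2 / Real.pi * f * Real.sinc (angle n k) ≤ symbol n k :=
      calc 2 / Real.pi * f * Real.sinc (angle n k)
          ≤ Real.sinc (angle n k) * symbolBound (angle n k) * Real.sinc (angle n k) := by
            have : 0 < Real.sinc (angle n k) := h0.trans_le h1
            gcongr
        _ = Real.sinc (angle n k) ^ 2 * symbolBound (angle n k) := by ring
        _ ≤ _ := le_symbol hkn
    have h4 : 0 ≤ 2 / Real.pi * f * Real.sinc (angle n k) := by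
      have := h0.trans_le h1
      positivity
    have h5 := pow_le_pow_left₀ h4 h3 2
    rw [cosCoeff_of_mem hT hv]
    calc (2 / Real.pi * f) ^ 2 * (Real.sinc (angle n k) * gridCoeff T n v k) ^ 2
        = (2 / Real.pi * f * Real.sinc (angle n k)) ^ 2 * gridCoeff T n v k ^ 2 := by ring
      _ ≤ symbol n k ^ 2 * gridCoeff T n v k ^ 2 := by gcongr
      _ = _ := by ring
  -- the frequencies above the cutoff are dropped
  have hsum : (2 / Real.pi * f) ^ 2 * ∑ k ∈ Finset.range (M + 1), cosCoeff T v k ^ 2 ≤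
      ∑ k ∈ Finset.range n, (gridCoeff T n v k * symbol n k) ^ 2 := by
    rw [Finset.mul_sum]
    refine (Finset.sum_le_sum hterm).trans ?_
    refine Finset.sum_le_sum_of_subset_of_nonneg (Finset.range_mono hM) fun _ _ _ => sq_nonneg _
  rw [stabConst_eq hn, mul_pow]
  calc (2 * Real.sqrt 3 / Real.pi ^ 2 * f) ^ 2 * ‖v‖ ^ 2
      ≤ (2 * Real.sqrt 3 / Real.pi ^ 2 * f) ^ 2 * (T / 2 * (Real.pi ^ 2 / 3) *
        ∑ k ∈ Finset.range (M + 1), cosCoeff T v k ^ 2) := by gcongr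
    _ = T / 2 * ((2 / Real.pi * f) ^ 2 * ∑ k ∈ Finset.range (M + 1), cosCoeff T v k ^ 2) := by
        have h3 : Real.sqrt 3 ^ 2 = 3 := Real.sq_sqrt (by norm_num)
        simp only [mul_pow, div_pow, h3]
        field_simp
    _ ≤ _ := by gcongr

theorem norm_le_mul_norm_discreteOp (hT : 0 < T) (hn : 0 < n) {v : L2 T}
    (hv : v ∈ pwConst T n) :
    ‖v‖ ≤ Real.pi ^ 2 * n / 2 * ‖projL2 T n (hilbTInv T v)‖ := by
  have hp := Real.pi_pos
  have h0 : (0 : ℝ) < n := by exact_mod_cast hn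
  have h : 2 / (Real.pi ^ 2 * n) * ‖v‖ ≤ ‖projL2 T n (hilbTInv T v)‖ := by
    refine le_of_sq_le_sq ?_ (norm_nonneg _)
    rw [norm_discreteOp_sq hT hv, mul_pow, norm_sq_of_mem hT hv, mul_left_comm, Finset.mul_sum]
    refine mul_le_mul_of_nonneg_left (Finset.sum_le_sum fun k hk => ?_) (half_pos hT).le
    rw [mul_pow, mul_comm]
    have := inv_le_symbol (Finset.mem_range.1 hk)
    gcongr
  calc ‖v‖ = Real.pi ^ 2 * n / 2 * (2 / (Real.pi ^ 2 * n) * ‖v‖) := by field_simp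
    _ ≤ _ := by gcongr

/-! ### The projection based on the modified Hilbert transformation -/

/-- Passing to the adjoint turns the defining equations into one for the discrete operator. -/
theorem isHilbProj_iff (hT : 0 < T) (u uh : L2 T) :
    IsHilbProj T n u uh ↔
      uh ∈ pwConst T n ∧ projL2 T n (hilbTInv T uh) = projL2 T n (hilbTInv T u) := by
  rw [IsHilbProj]
  refine and_congr_right fun _ => ?_
  simp_rw [← inner_hilbTInv_left hT]
  constructor
  · intro h
    refine projL2_eq_of_inner (projL2_mem _) fun i => ?_
    rw [real_inner_comm, inner_projL2_left (basisFn_mem i), real_inner_comm (hilbTInv T uh),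
      h _ (basisFn_mem i), real_inner_comm]
  · intro h v hv
    rw [← inner_projL2_left hv, h, inner_projL2_left hv]

theorem existsUnique_isHilbProj (hT : 0 < T) (hn : 0 < n) (u : L2 T) :
    ∃! uh : L2 T, IsHilbProj T n u uh := by
  set A : pwConst T n →ₗ[ℝ] pwConst T n := (discreteOp hT n).restrict (fun v _ => projL2_mem _)
    with hA
  have hAv : ∀ v : pwConst T n, (A v : L2 T) = projL2 T n (hilbTInv T v) := fun v => rfl
  have hinj : Function.Injective A := by
    rw [injective_iff_map_eq_zero]
    intro v hv
    have h := norm_le_mul_norm_discreteOp hT hn v.2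
    rw [← hAv, hv] at h
    simpa using h
  have hsurj := LinearMap.injective_iff_surjective.1 hinj
  obtain ⟨w, hw⟩ := hsurj ⟨projL2 T n (hilbTInv T u), projL2_mem _⟩
  refine ⟨w, (isHilbProj_iff hT _ _).2 ⟨w.2, ?_⟩, fun y hy => ?_⟩
  · rw [← hAv, hw]
  · obtain ⟨hy1, hy2⟩ := (isHilbProj_iff hT _ _).1 hy
    have : A ⟨y, hy1⟩ = A w := by
      rw [hw]
      exact Subtype.ext hy2
    exact congrArg Subtype.val (hinj this)

/-- The error equation of the projection. -/
theorem projL2_hilbTInv_sub (hT : 0 < T) {u uh : L2 T} (h : IsHilbProj T n u uh) :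
    projL2 T n (hilbTInv T (uh - projL2 T n u)) =
      projL2 T n (hilbTInv T (u - projL2 T n u)) := by
  have h1 := ((isHilbProj_iff hT _ _).1 h).2
  simp only [← discreteOp_apply hT] at h1 ⊢
  rw [map_sub, map_sub, h1]

/-! ### Parseval's identity for piecewise constant functions -/

/-- The Fourier series of a linear function, from that of the second Bernoulli polynomial at `y/2`
and `y`, whose difference leaves the odd frequencies. -/
theorem hasSum_cos_odd_div_sq {y : ℝ} (hy : y ∈ Icc (0 : ℝ) 1) :
    HasSum (fun k : ℕ => Real.cos ((2 * k + 1) * Real.pi * y) / (2 * (k : ℝ) + 1) ^ 2)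
      (Real.pi ^ 2 / 8 - Real.pi ^ 2 * y / 4) := by
  have key : ∀ x ∈ Icc (0 : ℝ) 1, HasSum (fun k : ℕ => 1 / (k : ℝ) ^ 2 *
      Real.cos (2 * Real.pi * k * x)) (Real.pi ^ 2 * (x ^ 2 - x + 1 / 6)) := by
    intro x hx
    have h := hasSum_one_div_nat_pow_mul_cos one_ne_zero hx
    have hb : Polynomial.bernoulli 2 =
        Polynomial.X ^ 2 - Polynomial.X + Polynomial.C (1 / 6 : ℚ) := by
      simp [Polynomial.bernoulli, Finset.sum_range_succ, ← Polynomial.C_mul_X_pow_eq_monomial,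
        bernoulli_two, bernoulli_one]
      have h2 : Polynomial.C (-1 / 2 : ℚ) * 2 = -1 := by
        rw [show (2 : Polynomial ℚ) = Polynomial.C 2 from rfl, ← Polynomial.C_mul]
        norm_num
      linear_combination Polynomial.X * h2
    have h3 : (-1 : ℝ) ^ (1 + 1) * (2 * Real.pi) ^ (2 * 1) / 2 / ((2 * 1).factorial : ℕ) *
        (Polynomial.map (algebraMap ℚ ℝ) (Polynomial.bernoulli (2 * 1))).eval x =
        Real.pi ^ 2 * (x ^ 2 - x + 1 / 6) := by
      rw [mul_one, hb]
      simp [Nat.factorial]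
      left
      ring
    rwa [h3] at h
  have h1 := key (y / 2) ⟨by linarith [hy.1], by linarith [hy.2]⟩
  have h2 := (key y hy).mul_left (1 / 4)
  set g : ℕ → ℝ := fun k => 1 / (k : ℝ) ^ 2 * Real.cos (2 * Real.pi * k * (y / 2)) with hg
  have h3 : HasSum (fun k => g (2 * k)) (1 / 4 * (Real.pi ^ 2 * (y ^ 2 - y + 1 / 6))) := by
    refine h2.congr_fun fun k => ?_
    simp only [hg]
    push_cast
    rw [show 2 * Real.pi * (2 * (k : ℝ)) * (y / 2) = 2 * Real.pi * k * y by ring, mul_pow]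
    ring
  have h4 : Summable fun k => g (2 * k + 1) :=
    h1.summable.comp_injective (fun a b h => by simpa using h)
  have h5 := (h3.even_add_odd h4.hasSum).unique h1
  have h6 := h4.hasSum
  rw [show ∑' k, g (2 * k + 1) = Real.pi ^ 2 / 8 - Real.pi ^ 2 * y / 4 by
    linear_combination h5] at h6
  refine h6.congr_fun fun k => ?_
  simp only [hg]
  push_cast
  rw [show 2 * Real.pi * (2 * (k : ℝ) + 1) * (y / 2) = (2 * k + 1) * Real.pi * y by ring]
  ring

/-- The indicator function of `(0,a)` in `L²(0,T)`. -/
def stepFn (T a : ℝ) : L2 T :=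
  indicatorConstLp 2 (measurableSet_Ioo : MeasurableSet (Ioo 0 a)) (measure_ne_top _ _) (1 : ℝ)

theorem inner_stepFn {a : ℝ} (ha : a ≤ T) (v : L2 T) :
    inner ℝ (stepFn T a) v = ∫ t in Ioo 0 a, v t := by
  rw [stepFn, L2.inner_indicatorConstLp_one, Measure.restrict_restrict measurableSet_Ioo,
    inter_eq_left.2 (Ioo_subset_Ioo le_rfl ha)]

theorem norm_stepFn_sq {a : ℝ} (h0 : 0 ≤ a) (ha : a ≤ T) : ‖stepFn T a‖ ^ 2 = a := by
  rw [← real_inner_self_eq_norm_sq, inner_stepFn ha]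
  have h : ∀ᵐ t ∂volume.restrict (Ioo 0 a), stepFn T a t = 1 := by
    filter_upwards [ae_restrict_of_ae_restrict_of_subset (Ioo_subset_Ioo le_rfl ha)
      (indicatorConstLp_coeFn (p := 2) (hs := (measurableSet_Ioo : MeasurableSet (Ioo 0 a)))
        (hμs := measure_ne_top (volume.restrict (Ioo (0 : ℝ) T)) (Ioo 0 a)) (c := (1 : ℝ))),
      ae_restrict_mem measurableSet_Ioo] with t ht htm
    rw [stepFn, ht, indicator_of_mem htm]
  rw [integral_congr_ae h]
  simp [h0]

theorem cosCoeff_stepFn (hT : 0 < T) {a : ℝ} (h0 : 0 ≤ a) (ha : a ≤ T) (k : ℕ) :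
    cosCoeff T (stepFn T a) k = 2 / T * (Real.sin (freq T k * a) / freq T k) := by
  rw [cosCoeff_eq, real_inner_comm, inner_stepFn ha, inv_div]
  congr 1
  rw [cosL2, integral_congr_ae (ae_restrict_of_ae_restrict_of_subset
    (Ioo_subset_Ioo le_rfl ha) (memLp_cos T k).coeFn_toLp), ← integral_Ioc_eq_integral_Ioo,
    ← intervalIntegral.integral_of_le h0,
    intervalIntegral.integral_comp_mul_left (fun x => Real.cos x) (freq_pos hT k).ne',
    integral_cos, mul_zero, Real.sin_zero, sub_zero, smul_eq_mul]
  ring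

/-- Parseval's identity for the cosine series of the indicator function of `(0,a)`. -/
theorem norm_hilbTInv_stepFn (hT : 0 < T) {a : ℝ} (h0 : 0 ≤ a) (ha : a ≤ T) :
    ‖hilbTInv T (stepFn T a)‖ = ‖stepFn T a‖ := by
  have hp := Real.pi_pos
  rw [← sq_eq_sq₀ (norm_nonneg _) (norm_nonneg _), norm_stepFn_sq h0 ha]
  refine (hasSum_norm_hilbTInv_sq hT _).unique ?_
  have h1 := hasSum_cos_odd_div_sq (y := 0) (by simp)
  have h2 := hasSum_cos_odd_div_sq (y := a / T) ⟨by positivity, (div_le_one hT).2 ha⟩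
  have h3 := (h1.sub h2).mul_left (4 * T / Real.pi ^ 2)
  rw [show 4 * T / Real.pi ^ 2 * (Real.pi ^ 2 / 8 - Real.pi ^ 2 * 0 / 4 -
    (Real.pi ^ 2 / 8 - Real.pi ^ 2 * (a / T) / 4)) = a by field_simp; ring] at h3
  refine h3.congr_fun fun k => ?_
  rw [cosCoeff_stepFn hT h0 ha, mul_zero, Real.cos_zero]
  have hw : freq T k = (2 * k + 1) * Real.pi / (2 * T) := by
    unfold freq
    field_simp
    ring
  have hc : Real.cos ((2 * k + 1) * Real.pi * (a / T)) = 1 - 2 * Real.sin (freq T k * a) ^ 2 := by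
    rw [show (2 * k + 1) * Real.pi * (a / T) = 2 * (freq T k * a) by rw [hw]; field_simp,
      Real.cos_two_mul, Real.cos_sq']
    ring
  rw [hc]
  generalize Real.sin (freq T k * a) = S
  rw [hw]
  have : (2 * (k : ℝ) + 1) ≠ 0 := by positivity
  field_simp
  ring

theorem basisFn_eq_sub (hT : 0 < T) (i : Fin n) :
    basisFn T n i = stepFn T (((i : ℝ) + 1) * (T / n)) - stepFn T ((i : ℝ) * (T / n)) := by
  have h0 : (0 : ℝ) < n := by exact_mod_cast i.pos
  have hle : (i : ℝ) * (T / n) ≤ ((i : ℝ) + 1) * (T / n) := by gcongr; linarith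
  have hi0 : (0 : ℝ) ≤ (i : ℝ) * (T / n) := by positivity
  refine Lp.ext ?_
  have hne : ∀ᵐ t ∂volume.restrict (Ioo (0 : ℝ) T), t ≠ (i : ℝ) * (T / n) :=
    ae_restrict_of_ae (Measure.ae_ne _ _)
  filter_upwards [hne, Lp.coeFn_sub (stepFn T (((i : ℝ) + 1) * (T / n)))
    (stepFn T ((i : ℝ) * (T / n))),
    indicatorConstLp_coeFn (p := 2)
      (hs := (measurableSet_Ioo : MeasurableSet (Ioo ((i : ℝ) * (T / n)) (((i : ℝ) + 1) * (T / n)))))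
      (hμs := measure_ne_top (volume.restrict (Ioo (0 : ℝ) T)) _) (c := (1 : ℝ)),
    indicatorConstLp_coeFn (p := 2)
      (hs := (measurableSet_Ioo : MeasurableSet (Ioo 0 (((i : ℝ) + 1) * (T / n)))))
      (hμs := measure_ne_top (volume.restrict (Ioo (0 : ℝ) T)) _) (c := (1 : ℝ)),
    indicatorConstLp_coeFn (p := 2)
      (hs := (measurableSet_Ioo : MeasurableSet (Ioo 0 ((i : ℝ) * (T / n)))))
      (hμs := measure_ne_top (volume.restrict (Ioo (0 : ℝ) T)) _) (c := (1 : ℝ))]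
    with t htne hsub h1 h2 h3
  rw [hsub, Pi.sub_apply, basisFn, stepFn, stepFn, h1, h2, h3]
  simp only [indicator, mem_Ioo]
  rcases lt_or_gt_of_ne htne with h | h
  · rw [if_neg (fun H => absurd H.1 (not_lt.2 h.le))]
    simp [h, h.trans_le hle]
  · simp [h, hi0.trans_lt h, not_lt.2 h.le]

theorem hilbT_hilbTInv_stepFn (hT : 0 < T) {a : ℝ} (h0 : 0 ≤ a) (ha : a ≤ T) :
    hilbT T (hilbTInv T (stepFn T a)) = stepFn T a := by
  have h := norm_hilbTInv_stepFn hT h0 ha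
  rw [hilbTInv_eq] at h
  rw [hilbTInv_eq, hilbT_eq]
  exact crossExp_crossExp_of_norm_eq (half_pos hT) (isOrth_cosL2 hT) (isOrth_sinL2 hT) _ h

/-- `hilbT` as a linear map. -/
def hilbTLin (hT : 0 < T) : L2 T →ₗ[ℝ] L2 T where
  toFun := hilbT T
  map_add' v w := by
    simp only [hilbT_eq]
    exact crossExp_add (half_pos hT) (isOrth_sinL2 hT) (isOrth_cosL2 hT) v w
  map_smul' c v := by
    simp only [hilbT_eq]
    exact crossExp_smul (half_pos hT) (isOrth_sinL2 hT) (isOrth_cosL2 hT) c v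

theorem hilbT_hilbTInv_of_mem (hT : 0 < T) {v : L2 T} (hv : v ∈ pwConst T n) :
    hilbT T (hilbTInv T v) = v := by
  have hle : pwConst T n ≤
      LinearMap.eqLocus (hilbTLin hT ∘ₗ hilbTInvLin hT) LinearMap.id := by
    rw [pwConst, Submodule.span_le]
    rintro _ ⟨i, rfl⟩
    have h0 : (0 : ℝ) < n := by exact_mod_cast i.pos
    have h1 : (i : ℝ) + 1 ≤ n := by exact_mod_cast i.2
    have h2 : ((i : ℝ) + 1) * (T / n) ≤ T :=
      calc ((i : ℝ) + 1) * (T / n) ≤ n * (T / n) := by gcongr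
        _ = T := by field_simp
    have h3 : (i : ℝ) * (T / n) ≤ ((i : ℝ) + 1) * (T / n) := by gcongr; linarith
    rw [SetLike.mem_coe, LinearMap.mem_eqLocus, basisFn_eq_sub hT, map_sub, map_sub]
    congr 1
    · exact hilbT_hilbTInv_stepFn hT (by positivity) h2
    · exact hilbT_hilbTInv_stepFn hT (by positivity) (h3.trans h2)
  exact hle hv

/-- Since piecewise constant functions are the sums of their cosine series, the projection of
`q` is controlled by the cosine coefficients of `q` only. -/
theorem norm_projL2_le_norm_hilbTInv (hT : 0 < T) (q : L2 T) :
    ‖projL2 T n q‖ ≤ ‖hilbTInv T q‖ := by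
  set v := projL2 T n q with hv
  have hvm : v ∈ pwConst T n := projL2_mem q
  have h1 : ‖v‖ ^ 2 ≤ ‖hilbTInv T q‖ * ‖v‖ :=
    calc ‖v‖ ^ 2 = inner ℝ q v := by
          rw [← real_inner_self_eq_norm_sq, ← inner_projL2_left hvm q]
      _ = inner ℝ (hilbTInv T q) (hilbTInv T v) := by
          rw [inner_hilbTInv_left hT, hilbT_hilbTInv_of_mem hT hvm]
      _ ≤ ‖hilbTInv T q‖ * ‖hilbTInv T v‖ := real_inner_le_norm _ _
      _ ≤ _ := by
          gcongr
          exact norm_hilbTInv_le hT v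
  rcases (norm_nonneg v).eq_or_lt with h | h
  · rw [← h]
    exact norm_nonneg _
  · rw [pow_two] at h1
    exact le_of_mul_le_mul_right h1 h

/-! ### The consistency error -/

/-- If the cosine coefficients of `u` decay like those of a function with `∂ₜ²u = w`, `∂ₜu(0) = 0`
and `u(T) = 0`, the consistency error is of second order: on the frequencies below `n` the defect
of the symbol is quadratic in the angle, and the others carry little of `u`. -/
theorem norm_discreteOp_sub_projL2_le (hT : 0 < T) (hn : 0 < n) {u w : L2 T}
    (huw : ∀ k, freq T k ^ 2 * |cosCoeff T u k| = |cosCoeff T w k|) :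
    ‖projL2 T n (hilbTInv T (u - projL2 T n u))‖ ≤ 3 * (T / n) ^ 2 * ‖w‖ := by
  have hp := Real.pi_gt_three
  have h0 : (0 : ℝ) < n := by exact_mod_cast hn
  set h := T / n with hh
  have hh0 : 0 < h := by positivity
  set p := ∑ k ∈ Finset.range n, cosCoeff T u k • cosL2 T k with hpdef
  set q := u - p with hq
  -- below `n` the operator is diagonal and its symbol nearly one
  have hlow : ‖projL2 T n (hilbTInv T (p - projL2 T n p))‖ ≤ h ^ 2 * ‖w‖ := by
    have e1 : projL2 T n (hilbTInv T (p - projL2 T n p)) = ∑ k ∈ Finset.range n,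
        (cosCoeff T u k * (Real.sinc (angle n k) * (1 - symbol n k))) • sinVec T n k := by
      have hpp : projL2 T n p =
          ∑ k ∈ Finset.range n, cosCoeff T u k • projL2 T n (cosL2 T k) := by
        simp only [projL2, hpdef, map_sum, map_smul]
      rw [hpp, hpdef, ← discreteOp_apply hT, ← Finset.sum_sub_distrib, map_sum]
      refine Finset.sum_congr rfl fun k hk => ?_
      rw [← smul_sub, map_smul, map_sub, discreteOp_apply, hilbTInv_cosL2 hT, projL2_sinL2 hT,
        projL2_cosL2 hT, map_smul, discreteOp_apply,
        projL2_hilbTInv_cosVec hT (Finset.mem_range.1 hk), ← smul_smul (cosCoeff T u k)]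
      congr 1
      module
    refine le_of_sq_le_sq ?_ (by positivity)
    rw [e1, norm_sum_sinVec_sq hT, mul_pow, Finset.mul_sum]
    refine le_trans (Finset.sum_le_sum fun k hk => ?_)
      ((Finset.mul_sum _ _ _).symm.le.trans (mul_le_mul_of_nonneg_left
        (sum_cosCoeff_sq_le hT w (Finset.range n)) (sq_nonneg _)))
    have hk := Finset.mem_range.1 hk
    have h1 := one_sub_symbol_le hk
    have h2 := symbol_le_one hk
    have h3 := Real.abs_sinc_le_one (angle n k)
    have h4 : 2 * angle n k = freq T k * h := (freq_mul hT hn k).symm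
    have h5 : |cosCoeff T u k * (Real.sinc (angle n k) * (1 - symbol n k))| ≤
        h ^ 2 * |cosCoeff T w k| := by
      rw [← huw k, abs_mul, abs_mul, abs_of_nonneg (sub_nonneg.2 h2)]
      calc |cosCoeff T u k| * (|Real.sinc (angle n k)| * (1 - symbol n k))
          ≤ |cosCoeff T u k| * (1 * (2 * angle n k ^ 2)) := by
            gcongr
        _ = |cosCoeff T u k| * ((2 * angle n k) ^ 2 / 2) := by ring
        _ ≤ |cosCoeff T u k| * (2 * angle n k) ^ 2 := by
            gcongr
            linarith [sq_nonneg (2 * angle n k)]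
        _ = _ := by rw [h4]; ring
    have h6 := pow_le_pow_left₀ (abs_nonneg _) h5 2
    rw [sq_abs, mul_pow (h ^ 2), sq_abs] at h6
    calc T / 2 * (cosCoeff T u k * (Real.sinc (angle n k) * (1 - symbol n k))) ^ 2
        ≤ T / 2 * ((h ^ 2) ^ 2 * cosCoeff T w k ^ 2) := by gcongr
      _ = _ := by ring
  have hqc : ∀ k, cosCoeff T q k = if k < n then 0 else cosCoeff T u k := by
    intro k
    have e : inner ℝ (cosL2 T k) p = if k < n then T / 2 * cosCoeff T u k else 0 := by
      rw [hpdef, inner_sum]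
      simp_rw [real_inner_smul_right, (inner_trig T hT _ _).2]
      simp [mul_comm]
    rw [cosCoeff_eq, hq, inner_sub_right, mul_sub, ← cosCoeff_eq, e]
    split_ifs with hk
    · field_simp
      ring
    · simp
  -- above `n` the frequencies are at least `1/h`
  have hhigh : ‖hilbTInv T q‖ ≤ h ^ 2 * ‖w‖ := by
    refine le_of_sq_le_sq ?_ (by positivity)
    refine hasSum_le_of_sum_le (hasSum_norm_hilbTInv_sq hT q) fun s => ?_
    rw [mul_pow]
    refine le_trans (Finset.sum_le_sum fun k hk => ?_)
      ((Finset.mul_sum _ _ _).symm.le.trans (mul_le_mul_of_nonneg_left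
        (sum_cosCoeff_sq_le hT w s) (sq_nonneg _)))
    rw [hqc]
    split_ifs with hkn
    · have : 0 ≤ (h ^ 2) ^ 2 * (T / 2 * cosCoeff T w k ^ 2) := by positivity
      simpa using this
    · have h1 : 1 ≤ freq T k * h := by
        have h2 : (n : ℝ) ≤ k := by exact_mod_cast not_lt.1 hkn
        rw [freq_mul hT hn, angle]
        rw [← mul_div_assoc, le_div_iff₀ (by positivity)]
        nlinarith
      have h5 : |cosCoeff T u k| ≤ h ^ 2 * |cosCoeff T w k| := by
        rw [← huw k, ← mul_assoc, ← mul_pow, mul_comm h]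
        exact le_mul_of_one_le_left (abs_nonneg _) (one_le_pow₀ h1)
      have h6 := pow_le_pow_left₀ (abs_nonneg _) h5 2
      rw [sq_abs, mul_pow, sq_abs] at h6
      calc T / 2 * cosCoeff T u k ^ 2 ≤ T / 2 * ((h ^ 2) ^ 2 * cosCoeff T w k ^ 2) := by gcongr
        _ = _ := by ring
  have hdec : projL2 T n (hilbTInv T (u - projL2 T n u)) =
      projL2 T n (hilbTInv T (p - projL2 T n p)) +
        (projL2 T n (hilbTInv T q) - projL2 T n (hilbTInv T (projL2 T n q))) := by
    have e : projL2 T n q = projL2 T n u - projL2 T n p := by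
      simp only [projL2, hq, map_sub]
    simp only [← discreteOp_apply hT]
    rw [e, hq]
    simp only [map_sub]
    abel
  calc ‖projL2 T n (hilbTInv T (u - projL2 T n u))‖
      ≤ ‖projL2 T n (hilbTInv T (p - projL2 T n p))‖ +
        (‖projL2 T n (hilbTInv T q)‖ + ‖projL2 T n (hilbTInv T (projL2 T n q))‖) := by
        rw [hdec]
        exact (norm_add_le _ _).trans (by gcongr; exact norm_sub_le _ _)
    _ ≤ h ^ 2 * ‖w‖ + (h ^ 2 * ‖w‖ + h ^ 2 * ‖w‖) := by
        gcongr
        · exact (norm_projL2_le _).trans hhigh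
        · exact (norm_projL2_le _).trans ((norm_hilbTInv_le hT _).trans
            ((norm_projL2_le_norm_hilbTInv hT q).trans hhigh))
    _ = _ := by ring

/-! ### Weak derivatives -/

theorem memLp_L2 (u : L2 T) : MemLp u 2 (volume.restrict (Ioo 0 T)) := Lp.memLp u

theorem integrableOn_L2 (u : L2 T) : IntegrableOn u (Ioo 0 T) :=
  (memLp_L2 u).integrable (by norm_num)

theorem intervalIntegrable_L2 (hT : 0 < T) (u : L2 T) : IntervalIntegrable u volume 0 T := by
  rw [intervalIntegrable_iff_integrableOn_Ioo_of_le hT.le]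
  exact integrableOn_L2 u

theorem integral_Ioo_eq (hT : 0 < T) (f : ℝ → ℝ) :
    ∫ t in Ioo 0 T, f t = ∫ t in (0 : ℝ)..T, f t := by
  rw [intervalIntegral.integral_of_le hT.le, integral_Ioc_eq_integral_Ioo]

theorem integrableOn_mul_continuous {f φ : ℝ → ℝ} (hf : IntegrableOn f (Ioo 0 T))
    (hφ : Continuous φ) : IntegrableOn (fun t => f t * φ t) (Ioo 0 T) := by
  rw [← integrableOn_Icc_iff_integrableOn_Ioo] at hf ⊢
  exact hf.mul_continuousOn hφ.continuousOn isCompact_Icc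

/-- Integration by parts for an indefinite integral and a continuously differentiable
function. -/
theorem integral_primitive_mul_deriv (hT : 0 < T) {g : ℝ → ℝ}
    (hg : IntervalIntegrable g volume 0 T) (a : ℝ) {φ φ' : ℝ → ℝ}
    (hφ : ∀ t, HasDerivAt φ (φ' t) t) (hφ' : Continuous φ') :
    ∫ t in Ioo 0 T, (a + ∫ x in (0 : ℝ)..t, g x) * φ' t =
      (a + ∫ x in (0 : ℝ)..T, g x) * φ T - a * φ 0 - ∫ t in Ioo 0 T, g t * φ t := by
  have hd : deriv φ = φ' := funext fun t => (hφ t).deriv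
  have hC : ContDiff ℝ 1 φ :=
    contDiff_one_iff_deriv.2 ⟨fun t => (hφ t).differentiableAt, by rwa [hd]⟩
  have hac : AbsolutelyContinuousOnInterval (fun t => ∫ x in (0 : ℝ)..t, g x) 0 T :=
    hg.absolutelyContinuousOnInterval_intervalIntegral (by simp)
  have hacφ : AbsolutelyContinuousOnInterval φ 0 T := hC.contDiffOn.absolutelyContinuousOnInterval
  have h := hac.integral_mul_deriv_eq_deriv_mul hacφ
  rw [hd] at h
  have hg' : ∫ t in (0 : ℝ)..T, deriv (fun t => ∫ x in (0 : ℝ)..t, g x) t * φ t =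
      ∫ t in (0 : ℝ)..T, g t * φ t := by
    refine intervalIntegral.integral_congr_ae ?_
    filter_upwards [hg.ae_hasDerivAt_integral] with t ht hmem
    rw [(ht (uIoc_subset_uIcc hmem) 0 (by simp)).deriv]
  have hφT : ∫ t in (0 : ℝ)..T, φ' t = φ T - φ 0 :=
    intervalIntegral.integral_eq_sub_of_hasDerivAt (fun t _ => hφ t)
      (hφ'.intervalIntegrable _ _)
  rw [hg', intervalIntegral.integral_same, zero_mul, sub_zero] at h
  have hi : IntervalIntegrable (fun t => (∫ x in (0 : ℝ)..t, g x) * φ' t) volume 0 T :=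
    (hac.continuousOn.mul hφ'.continuousOn).intervalIntegrable
  rw [integral_Ioo_eq hT, integral_Ioo_eq hT]
  simp_rw [add_mul]
  rw [intervalIntegral.integral_add ((hφ'.intervalIntegrable _ _).const_mul a) hi, h,
    intervalIntegral.integral_const_mul, hφT]
  ring

/-- The fundamental lemma of the calculus of variations on `(0,T)`. -/
theorem ae_eq_zero_of_integral_test_eq_zero {f : ℝ → ℝ} (hf : IntegrableOn f (Ioo 0 T))
    (h : ∀ φ : ℝ → ℝ, ContDiff ℝ (⊤ : ℕ∞) φ → HasCompactSupport φ → tsupport φ ⊆ Ioo 0 T →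
      ∫ t in Ioo 0 T, f t * φ t = 0) : ∀ᵐ t ∂volume.restrict (Ioo 0 T), f t = 0 := by
  rw [ae_restrict_iff' measurableSet_Ioo]
  refine isOpen_Ioo.ae_eq_zero_of_integral_contDiff_smul_eq_zero hf.locallyIntegrableOn
    fun φ h1 h2 h3 => ?_
  rw [← h φ h1 h2 h3, ← setIntegral_eq_integral_of_forall_compl_eq_zero (s := Ioo 0 T)]
  · simp only [smul_eq_mul, mul_comm]
  · intro t ht
    rw [image_eq_zero_of_notMem_tsupport (fun h => ht (h3 h)), zero_smul]

theorem IsWeakDeriv.unique {u g₁ g₂ : L2 T} (h₁ : IsWeakDeriv T u g₁) (h₂ : IsWeakDeriv T u g₂) :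
    g₁ = g₂ := by
  refine Lp.ext ?_
  have h := ae_eq_zero_of_integral_test_eq_zero (T := T) (f := fun t => g₁ t - g₂ t)
    ((integrableOn_L2 g₁).sub (integrableOn_L2 g₂)) fun φ hφ h2 h3 => by
      have e1 := h₁ φ hφ h2 h3
      have e2 := h₂ φ hφ h2 h3
      simp_rw [sub_mul]
      rw [integral_sub (integrableOn_mul_continuous (integrableOn_L2 g₁) hφ.continuous)
        (integrableOn_mul_continuous (integrableOn_L2 g₂) hφ.continuous)]
      linarith
  filter_upwards [h] with t ht
  linarith

/-- A test function with vanishing integral is the derivative of a test function. -/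
theorem exists_test_primitive (hT : 0 < T) {f : ℝ → ℝ} (hf : ContDiff ℝ (⊤ : ℕ∞) f)
    (hc : HasCompactSupport f) (hs : tsupport f ⊆ Ioo 0 T)
    (hi : ∫ t in (0 : ℝ)..T, f t = 0) :
    ∃ φ : ℝ → ℝ, ContDiff ℝ (⊤ : ℕ∞) φ ∧ HasCompactSupport φ ∧ tsupport φ ⊆ Ioo 0 T ∧
      deriv φ = f := by
  have hfc := hf.continuous
  -- outside `[α, β]` the primitive is constant, and both constants vanish
  obtain ⟨α, β, hα, hβ, hαβ⟩ : ∃ α β : ℝ, 0 < α ∧ β < T ∧ tsupport f ⊆ Icc α β := by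
    rcases (tsupport f).eq_empty_or_nonempty with h | h
    · exact ⟨T / 2, T / 2, by linarith, by linarith, by simp [h]⟩
    · obtain ⟨α, hα⟩ := hc.isCompact.exists_isLeast h
      obtain ⟨β, hβ⟩ := hc.isCompact.exists_isGreatest h
      exact ⟨α, β, (hs hα.1).1, (hs hβ.1).2, fun t ht => ⟨hα.2 ht, hβ.2 ht⟩⟩
  have hf0 : ∀ t, t ∉ Icc α β → f t = 0 := fun t ht =>
    image_eq_zero_of_notMem_tsupport fun h => ht (hαβ h)
  have hd : ∀ t, HasDerivAt (fun t => ∫ x in (0 : ℝ)..t, f x) (f t) t := fun t =>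
    intervalIntegral.integral_hasDerivAt_right (hfc.intervalIntegrable _ _)
      (hfc.stronglyMeasurableAtFilter _ _) hfc.continuousAt
  have hderiv : deriv (fun t => ∫ x in (0 : ℝ)..t, f x) = f := funext fun t => (hd t).deriv
  have hsupp : Function.support (fun t => ∫ x in (0 : ℝ)..t, f x) ⊆ Icc α β := by
    intro t ht
    by_contra hmem
    refine ht ?_
    rw [mem_Icc, not_and_or, not_le, not_le] at hmem
    rcases hmem with hlt | hlt
    · refine intervalIntegral.integral_zero_ae (Filter.Eventually.of_forall fun x hx => ?_)
      refine hf0 x fun h => ?_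
      rcases uIoc_subset_uIcc hx with ⟨-, h2⟩
      have : x ≤ max 0 t := h2
      rcases max_le_iff.1 (max_le hα.le hlt.le) with ⟨h3, h4⟩
      exact absurd (h.1.trans this) (not_le.2 (max_lt hα hlt))
    · have h1 : ∫ x in T..t, f x = 0 := by
        refine intervalIntegral.integral_zero_ae (Filter.Eventually.of_forall fun x hx => ?_)
        refine hf0 x fun h => ?_
        have h2 : min T t ≤ x := (uIoc_subset_uIcc hx).1
        exact absurd (h2.trans h.2) (not_le.2 (lt_min hβ hlt))
      have h2 := intervalIntegral.integral_add_adjacent_intervals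
        (hfc.intervalIntegrable (μ := volume) 0 T) (hfc.intervalIntegrable T t)
      change ∫ x in (0 : ℝ)..t, f x = 0
      rw [← h2, hi, h1, add_zero]
  have hts : tsupport (fun t => ∫ x in (0 : ℝ)..t, f x) ⊆ Icc α β :=
    closure_minimal hsupp isClosed_Icc
  refine ⟨fun t => ∫ x in (0 : ℝ)..t, f x, ?_, ?_, ?_, hderiv⟩
  · rw [contDiff_infty_iff_deriv, hderiv]
    exact ⟨fun t => (hd t).differentiableAt, hf⟩
  · exact HasCompactSupport.of_support_subset_isCompact isCompact_Icc hsupp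
  · exact hts.trans (Icc_subset_Ioo hα hβ)

/-- A function with a weak derivative in `L²(0,T)` is an indefinite integral of it
(the lemma of du Bois-Reymond). -/
theorem IsWeakDeriv.exists_ae_eq (hT : 0 < T) {u g : L2 T} (h : IsWeakDeriv T u g) :
    ∃ a : ℝ, ∀ᵐ t ∂volume.restrict (Ioo 0 T), u t = a + ∫ x in (0 : ℝ)..t, g x := by
  have hg := intervalIntegrable_L2 hT g
  set G : ℝ → ℝ := fun t => ∫ x in (0 : ℝ)..t, g x with hG
  have hGc : ContinuousOn G (Icc 0 T) := by
    have := (hg.absolutelyContinuousOnInterval_intervalIntegral (c := 0) (by simp)).continuousOn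
    rwa [uIcc_of_le hT.le] at this
  have hGi : IntegrableOn G (Ioo 0 T) := (hGc.integrableOn_Icc).mono_set Ioo_subset_Icc_self
  -- the difference has a vanishing weak derivative, so that it is constant
  set w : ℝ → ℝ := fun t => u t - G t with hw
  have hwi : IntegrableOn w (Ioo 0 T) := (integrableOn_L2 u).sub hGi
  have hwφ : ∀ φ : ℝ → ℝ, ContDiff ℝ (⊤ : ℕ∞) φ → HasCompactSupport φ → tsupport φ ⊆ Ioo 0 T →
      ∫ t in Ioo 0 T, w t * deriv φ t = 0 := by
    intro φ hφ hc hs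
    have hdc : Continuous (deriv φ) := hφ.continuous_deriv (by simp)
    have hz : ∀ t, t ∉ Ioo 0 T → φ t = 0 := fun t ht =>
      image_eq_zero_of_notMem_tsupport fun h => ht (hs h)
    have h1 := integral_primitive_mul_deriv hT hg 0
      (fun t => (hφ.differentiable (by simp) t).hasDerivAt) hdc
    rw [hz T (by simp), hz 0 (by simp)] at h1
    simp only [zero_add, mul_zero, sub_self, zero_sub] at h1
    have h2 := h φ hφ hc hs
    simp_rw [hw, sub_mul]
    rw [integral_sub (integrableOn_mul_continuous (integrableOn_L2 u) hdc)
      (integrableOn_mul_continuous hGi hdc), h2, h1, sub_self]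
  -- a fixed test function with integral one
  let b : ContDiffBump (T / 2 : ℝ) := ⟨T / 8, T / 4, by positivity, by linarith⟩
  set η : ℝ → ℝ := b.normed volume with hη
  have hηs : tsupport η ⊆ Ioo 0 T := by
    rw [hη, b.tsupport_normed_eq, Real.closedBall_eq_Icc]
    refine Icc_subset_Ioo ?_ ?_ <;> simp only [b] <;> linarith
  have hηi : ∫ t in (0 : ℝ)..T, η t = 1 := by
    rw [← integral_Ioo_eq hT, setIntegral_eq_integral_of_forall_compl_eq_zero, b.integral_normed]
    intro t ht
    exact image_eq_zero_of_notMem_tsupport fun h => ht (hηs h)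
  have hηd : ContDiff ℝ (⊤ : ℕ∞) η := b.contDiff_normed
  have hηc : HasCompactSupport η := b.hasCompactSupport_normed
  set a := ∫ t in Ioo 0 T, w t * η t with ha
  refine ⟨a, ?_⟩
  have key := ae_eq_zero_of_integral_test_eq_zero (T := T) (f := fun t => w t - a)
    (hwi.sub (integrable_const _)) fun ψ hψ hψc hψs => by
      set m := ∫ t in (0 : ℝ)..T, ψ t with hm
      have hfd : ContDiff ℝ (⊤ : ℕ∞) (fun t => ψ t - m * η t) := hψ.sub (contDiff_const.mul hηd)
      have hsub : Function.support (fun t => ψ t - m * η t) ⊆ tsupport ψ ∪ tsupport η := by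
        intro t ht
        by_contra hn
        rw [mem_union, not_or] at hn
        refine ht ?_
        simp [image_eq_zero_of_notMem_tsupport hn.1, image_eq_zero_of_notMem_tsupport hn.2]
      have hK : IsCompact (tsupport ψ ∪ tsupport η) := hψc.isCompact.union hηc.isCompact
      obtain ⟨φ, h1, h2, h3, h4⟩ := exists_test_primitive hT hfd
        (HasCompactSupport.of_support_subset_isCompact hK hsub)
        ((closure_minimal hsub hK.isClosed).trans (union_subset hψs hηs)) (by
          rw [intervalIntegral.integral_sub (hψ.continuous.intervalIntegrable _ _)
            ((hηd.continuous.intervalIntegrable _ _).const_mul m),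
            intervalIntegral.integral_const_mul, hηi, ← hm]
          ring)
      have h5 := hwφ φ h1 h2 h3
      rw [h4] at h5
      have e : ∀ t, w t * (ψ t - m * η t) = w t * ψ t - m * (w t * η t) := fun t => by ring
      simp_rw [e] at h5
      have i1 := integrableOn_mul_continuous hwi hψ.continuous
      have i2 := integrableOn_mul_continuous hwi hηd.continuous
      rw [integral_sub i1 (i2.const_mul m), integral_const_mul, ← ha] at h5
      simp_rw [sub_mul]
      rw [integral_sub i1 ((hψ.continuous.integrableOn_Icc (a := 0) (b := T)).mono_set
        Ioo_subset_Icc_self |>.const_mul a), integral_const_mul, integral_Ioo_eq hT ψ, ← hm]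
      linarith
  filter_upwards [key] with t ht
  simp only [hw, hG] at ht
  linarith

/-! ### Approximation by piecewise constant functions -/

/-- The `i`-th element of the mesh. -/
abbrev elem (T : ℝ) (n i : ℕ) : Set ℝ := Ioo ((i : ℝ) * (T / n)) (((i : ℝ) + 1) * (T / n))

theorem elem_pairwise_disjoint (hT : 0 < T) (n : ℕ) :
    Pairwise (Function.onFun Disjoint (elem T n)) := by
  intro i j hij
  rw [Function.onFun, disjoint_left]
  intro t hi hj
  have hp : 0 ≤ T / n := by positivity
  rcases lt_or_gt_of_ne hij with h | h
  · have h1 : (i : ℝ) + 1 ≤ j := by exact_mod_cast h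
    linarith [hi.2, hj.1, mul_le_mul_of_nonneg_right h1 hp]
  · have h1 : (j : ℝ) + 1 ≤ i := by exact_mod_cast h
    linarith [hj.2, hi.1, mul_le_mul_of_nonneg_right h1 hp]

theorem elem_subset' (hT : 0 < T) {i : ℕ} (hi : i < n) : elem T n i ⊆ Ioo 0 T :=
  elem_subset hT ⟨i, hi⟩

theorem sum_lintegral_elem_le (hT : 0 < T) (n : ℕ) (F : ℝ → ℝ≥0∞) :
    ∑ i ∈ Finset.range n, ∫⁻ t in elem T n i, F t ≤ ∫⁻ t in Ioo 0 T, F t := by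
  rw [← lintegral_biUnion_finset (fun i _ j _ hij => elem_pairwise_disjoint hT n hij)
    (fun i _ => measurableSet_Ioo)]
  refine lintegral_mono_set (iUnion₂_subset fun i hi => elem_subset' hT (Finset.mem_range.1 hi))

theorem sum_integral_elem (hT : 0 < T) (hn : 0 < n) {f : ℝ → ℝ} (hf : IntegrableOn f (Ioo 0 T)) :
    ∑ i ∈ Finset.range n, ∫ t in elem T n i, f t = ∫ t in Ioo 0 T, f t := by
  have h0 : (0 : ℝ) < n := by exact_mod_cast hn
  have hp : 0 < T / n := by positivity
  have hle : ∀ i : ℕ, (i : ℝ) * (T / n) ≤ ((i : ℝ) + 1) * (T / n) := fun i => by nlinarith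
  have h := intervalIntegral.sum_integral_adjacent_intervals (f := f) (μ := volume)
    (a := fun i : ℕ => (i : ℝ) * (T / n)) (n := n) (fun i hi => by
      rw [intervalIntegrable_iff_integrableOn_Ioo_of_le (by push_cast; exact hle i)]
      push_cast
      exact hf.mono_set (elem_subset' hT hi))
  simp only [Nat.cast_zero, zero_mul] at h
  rw [show (n : ℝ) * (T / n) = T by field_simp, ← integral_Ioo_eq hT] at h
  rw [← h]
  refine Finset.sum_congr rfl fun i _ => ?_
  push_cast
  rw [intervalIntegral.integral_of_le (hle i), integral_Ioc_eq_integral_Ioo]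

/-- The double integral of the squared differences is twice the variance. -/
theorem lintegral_lintegral_sub_sq {μ : Measure ℝ} [IsFiniteMeasure μ] {v : ℝ → ℝ}
    (hv : MemLp v 2 μ) :
    ∫⁻ x, ∫⁻ y, ENNReal.ofReal ((v x - v y) ^ 2) ∂μ ∂μ =
      ENNReal.ofReal (2 * (μ.real univ * ∫ x, v x ^ 2 ∂μ - (∫ x, v x ∂μ) ^ 2)) := by
  have h1 : Integrable v μ := hv.integrable (by norm_num)
  have h2 : Integrable (fun x => v x ^ 2) μ := hv.integrable_sq
  set A := ∫ x, v x ∂μ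
  set B := ∫ x, v x ^ 2 ∂μ
  have hin : ∀ c : ℝ, Integrable (fun y => (c - v y) ^ 2) μ := fun c => by
    have : Integrable (fun y => c ^ 2 - 2 * c * v y + v y ^ 2) μ :=
      ((integrable_const _).sub (h1.const_mul _)).add h2
    refine this.congr (Filter.Eventually.of_forall fun y => ?_)
    change c ^ 2 - 2 * c * v y + v y ^ 2 = (c - v y) ^ 2
    ring
  have hval : ∀ c : ℝ, ∫ y, (c - v y) ^ 2 ∂μ = μ.real univ * c ^ 2 - 2 * c * A + B := fun c => by
    have e : ∀ y, (c - v y) ^ 2 = c ^ 2 - 2 * c * v y + v y ^ 2 := fun y => by ring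
    simp_rw [e]
    rw [integral_add (f := fun y => c ^ 2 - 2 * c * v y)
      ((integrable_const _).sub (h1.const_mul _)) h2,
      integral_sub (integrable_const _) (h1.const_mul _), integral_const, integral_const_mul,
      smul_eq_mul]
  have hinner : ∀ x, ∫⁻ y, ENNReal.ofReal ((v x - v y) ^ 2) ∂μ =
      ENNReal.ofReal (μ.real univ * v x ^ 2 - 2 * v x * A + B) := fun x => by
    rw [← hval, ofReal_integral_eq_lintegral_ofReal (hin _)
      (Filter.Eventually.of_forall fun y => sq_nonneg _)]
  simp_rw [hinner]
  have i1 : Integrable (fun x => μ.real univ * v x ^ 2) μ := h2.const_mul _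
  have i2 : Integrable (fun x => 2 * v x * A) μ := (h1.const_mul 2).mul_const A
  have i3 : Integrable (fun x => μ.real univ * v x ^ 2 - 2 * v x * A + B) μ :=
    (i1.sub i2).add (integrable_const B)
  rw [← ofReal_integral_eq_lintegral_ofReal i3
    (Filter.Eventually.of_forall fun x => by
      change 0 ≤ μ.real univ * v x ^ 2 - 2 * v x * A + B
      rw [← hval]
      exact integral_nonneg fun y => sq_nonneg _)]
  congr 1
  rw [integral_add (f := fun x => μ.real univ * v x ^ 2 - 2 * v x * A) (i1.sub i2)
    (integrable_const B), integral_sub i1 i2, integral_const_mul, integral_mul_const,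
    integral_const_mul, integral_const, smul_eq_mul]
  ring

theorem norm_sq_eq_integral (u : L2 T) : ‖u‖ ^ 2 = ∫ t in Ioo 0 T, u t ^ 2 := by
  rw [← real_inner_self_eq_norm_sq, L2.inner_def]
  refine integral_congr_ae (Filter.Eventually.of_forall fun t => ?_)
  simp [pow_two]

theorem integrableOn_sq (u : L2 T) : IntegrableOn (fun t => u t ^ 2) (Ioo 0 T) :=
  (memLp_L2 u).integrable_sq

/-- The squared distance to the piecewise constants is the sum of the variances on the elements. -/
theorem norm_sub_projL2_sq (hT : 0 < T) (hn : 0 < n) (u : L2 T) :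
    ‖u - projL2 T n u‖ ^ 2 = ∑ i ∈ Finset.range n,
      ((∫ t in elem T n i, u t ^ 2) - (T / n)⁻¹ * (∫ t in elem T n i, u t) ^ 2) := by
  have h0 : (0 : ℝ) < n := by exact_mod_cast hn
  set c : Fin n → ℝ := fun i => (T / n)⁻¹ * ∫ t in elem T n i, u t with hc
  have hproj : projL2 T n u = ∑ i, c i • basisFn T n i := by
    refine projL2_eq_of_inner (Submodule.sum_mem _ fun i _ =>
      Submodule.smul_mem _ _ (basisFn_mem i)) fun i => ?_
    rw [inner_basisFn_sum hT, inner_basisFn hT, hc, mul_inv_cancel_left₀ (by positivity)]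
  have h1 : ‖u - projL2 T n u‖ ^ 2 = ‖u‖ ^ 2 - inner ℝ (projL2 T n u) (projL2 T n u) := by
    rw [norm_sub_sq_real, ← inner_projL2_left (projL2_mem u) u, real_inner_self_eq_norm_sq]
    ring
  rw [h1, hproj, inner_sum_sum hT, norm_sq_eq_integral, ← sum_integral_elem hT hn
    (integrableOn_sq u), Finset.sum_sub_distrib, Finset.mul_sum]
  congr 1
  rw [Finset.sum_range]
  refine Finset.sum_congr rfl fun i _ => ?_
  simp only [hc]
  field_simp

/-- The variance on each element is bounded by the double integral of the squared differences, which
serves both the Slobodeckij seminorm and the weak derivative. -/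
theorem ofReal_norm_sub_projL2_sq (hT : 0 < T) (hn : 0 < n) (u : L2 T) :
    ENNReal.ofReal (‖u - projL2 T n u‖ ^ 2) ≤ ENNReal.ofReal (T / n)⁻¹ *
      ∑ i ∈ Finset.range n, ∫⁻ x in elem T n i, ∫⁻ y in elem T n i,
        ENNReal.ofReal ((u x - u y) ^ 2) := by
  have h0 : (0 : ℝ) < n := by exact_mod_cast hn
  have hh : 0 < T / n := by positivity
  rw [norm_sub_projL2_sq hT hn, Finset.mul_sum]
  have hle : ∀ (s : Finset ℕ) (f : ℕ → ℝ),
      ENNReal.ofReal (∑ i ∈ s, f i) ≤ ∑ i ∈ s, ENNReal.ofReal (f i) := fun s f =>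
    Finset.le_sum_of_subadditive ENNReal.ofReal ENNReal.ofReal_zero.le
      (fun _ _ => ENNReal.ofReal_add_le) s f
  refine (hle _ _).trans (Finset.sum_le_sum fun i hi => ?_)
  have hm : MemLp u 2 (volume.restrict (elem T n i)) :=
    (memLp_L2 u).mono_measure (Measure.restrict_mono (elem_subset' hT (Finset.mem_range.1 hi)) le_rfl)
  have hlen : (volume.restrict (elem T n i)).real univ = T / n := by
    rw [measureReal_restrict_apply_univ, Real.volume_real_Ioo_of_le (by nlinarith)]
    ring
  rw [lintegral_lintegral_sub_sq hm, hlen, ← ENNReal.ofReal_mul (by positivity)]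
  set A := ∫ t in elem T n i, u t
  set B := ∫ t in elem T n i, u t ^ 2
  have e : (T / n)⁻¹ * (2 * (T / n * B - A ^ 2)) = 2 * (B - (T / n)⁻¹ * A ^ 2) := by
    field_simp
  rw [e]
  rcases le_total 0 (B - (T / n)⁻¹ * A ^ 2) with h | h
  · exact ENNReal.ofReal_le_ofReal (by linarith)
  · rw [ENNReal.ofReal_of_nonpos h]
    exact zero_le

/-- On one element `|x - y| ≤ h`, so that the weight `|x - y|^(-1-2σ)` is at least `h^(-1-2σ)`. -/
theorem ofReal_sq_norm_le_of_slobodeckij (hT : 0 < T) (hn : 0 < n) {σ : ℝ} (hσ : 0 < σ) (u : L2 T) :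
    ENNReal.ofReal (‖u - projL2 T n u‖ ^ 2) ≤
      ENNReal.ofReal (((T / n) ^ σ) ^ 2) * slobodeckijSq T σ u := by
  have h0 : (0 : ℝ) < n := by exact_mod_cast hn
  have hh : 0 < T / n := by positivity
  refine (ofReal_norm_sub_projL2_sq hT hn u).trans ?_
  have hpt : ∀ i ∈ Finset.range n, ∫⁻ x in elem T n i, ∫⁻ y in elem T n i,
      ENNReal.ofReal ((u x - u y) ^ 2) ≤ ENNReal.ofReal ((T / n) ^ (1 + 2 * σ)) *
      ∫⁻ x in elem T n i, ∫⁻ y in Ioo 0 T,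
        ENNReal.ofReal (|u x - u y| ^ 2 / |x - y| ^ (1 + 2 * σ)) := by
    intro i hi
    rw [← lintegral_const_mul' _ _ ENNReal.ofReal_ne_top]
    refine setLIntegral_mono' measurableSet_Ioo fun x hx => ?_
    rw [← lintegral_const_mul' _ _ ENNReal.ofReal_ne_top]
    refine le_trans ?_ (lintegral_mono_set (elem_subset' hT (Finset.mem_range.1 hi)))
    refine setLIntegral_mono' measurableSet_Ioo fun y hy => ?_
    rw [← ENNReal.ofReal_mul (by positivity)]
    refine ENNReal.ofReal_le_ofReal ?_
    rw [sq_abs]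
    rcases eq_or_ne x y with rfl | hxy
    · simp
    · have hd : 0 < |x - y| := abs_pos.2 (sub_ne_zero.2 hxy)
      have hd' : |x - y| ≤ T / n := by
        rw [abs_le]
        constructor <;> nlinarith [hx.1, hx.2, hy.1, hy.2]
      have hr : |x - y| ^ (1 + 2 * σ) ≤ (T / n) ^ (1 + 2 * σ) :=
        Real.rpow_le_rpow hd.le hd' (by linarith)
      have hr0 : 0 < |x - y| ^ (1 + 2 * σ) := Real.rpow_pos_of_pos hd _
      rw [mul_div_assoc', le_div_iff₀ hr0, mul_comm]
      gcongr
  calc _ ≤ ENNReal.ofReal (T / n)⁻¹ * (ENNReal.ofReal ((T / n) ^ (1 + 2 * σ)) *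
        slobodeckijSq T σ u) := by
        gcongr
        refine (Finset.sum_le_sum hpt).trans ?_
        rw [← Finset.mul_sum]
        gcongr
        exact sum_lintegral_elem_le hT n _
    _ = _ := by
        rw [← mul_assoc, ← ENNReal.ofReal_mul (by positivity)]
        congr 2
        rw [Real.rpow_add hh, Real.rpow_one, inv_mul_cancel_left₀ hh.ne', mul_comm 2 σ,
          Real.rpow_mul hh.le]
        norm_num

theorem norm_sub_projL2_le_of_isWeakDeriv (hT : 0 < T) (hn : 0 < n) {u g : L2 T}
    (h : IsWeakDeriv T u g) : ‖u - projL2 T n u‖ ≤ T / n * ‖g‖ := by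
  have h0 : (0 : ℝ) < n := by exact_mod_cast hn
  have hh : 0 < T / n := by positivity
  obtain ⟨a, ha⟩ := h.exists_ae_eq hT
  have hg := intervalIntegrable_L2 hT g
  -- the Cauchy-Schwarz inequality on one element
  have hcs : ∀ i ∈ Finset.range n, ∀ x ∈ elem T n i, ∀ y ∈ elem T n i,
      ((∫ t in (0 : ℝ)..x, g t) - ∫ t in (0 : ℝ)..y, g t) ^ 2 ≤
        T / n * ∫ t in elem T n i, g t ^ 2 := by
    intro i hi
    have hsub := elem_subset' hT (Finset.mem_range.1 hi)
    have hsq := (integrableOn_sq g).mono_set hsub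
    have hle : ∀ x ∈ elem T n i, ∀ y ∈ elem T n i, y ≤ x →
        ((∫ t in (0 : ℝ)..x, g t) - ∫ t in (0 : ℝ)..y, g t) ^ 2 ≤
          T / n * ∫ t in elem T n i, g t ^ 2 := by
      intro x hx y hy hyx
      have hIoo : Ioo y x ⊆ elem T n i := Ioo_subset_Ioo hy.1.le hx.2.le
      have hii : ∀ z ∈ elem T n i, IntervalIntegrable g volume 0 z := fun z hz =>
        hg.mono_set (by
          rw [uIcc_of_le (hsub hz).1.le, uIcc_of_le hT.le]
          exact Icc_subset_Icc le_rfl (hsub hz).2.le)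
      rw [intervalIntegral.integral_interval_sub_left (hii x hx) (hii y hy),
        intervalIntegral.integral_of_le hyx, integral_Ioc_eq_integral_Ioo]
      have hm : MemLp g 2 (volume.restrict (Ioo y x)) :=
        (memLp_L2 g).mono_measure (Measure.restrict_mono (hIoo.trans hsub) le_rfl)
      have hvar : 0 ≤ (volume.restrict (Ioo y x)).real univ * (∫ t in Ioo y x, g t ^ 2) -
          (∫ t in Ioo y x, g t) ^ 2 := by
        set m := (volume.restrict (Ioo y x)).real univ with hmdef
        set A := ∫ t in Ioo y x, g t with hA
        set B := ∫ t in Ioo y x, g t ^ 2 with hB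
        have h1 : Integrable g (volume.restrict (Ioo y x)) := hm.integrable (by norm_num)
        have h2 : Integrable (fun t => g t ^ 2) (volume.restrict (Ioo y x)) := hm.integrable_sq
        have hnn : 0 ≤ ∫ t in Ioo y x, (m * g t - A) ^ 2 := integral_nonneg fun t => sq_nonneg _
        have e : ∀ t, (m * g t - A) ^ 2 = m ^ 2 * g t ^ 2 - 2 * m * A * g t + A ^ 2 :=
          fun t => by ring
        simp_rw [e] at hnn
        rw [integral_add (f := fun t => m ^ 2 * g t ^ 2 - 2 * m * A * g t)
          ((h2.const_mul _).sub (h1.const_mul _)) (integrable_const _),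
          integral_sub (h2.const_mul _) (h1.const_mul _), integral_const_mul, integral_const_mul,
          integral_const, smul_eq_mul, ← hmdef, ← hA, ← hB] at hnn
        -- dividing by the length is possible unless the interval is degenerate
        have hm0 : 0 ≤ m := measureReal_nonneg
        rcases hm0.eq_or_lt with hm0 | hm0
        · have hz : volume.restrict (Ioo y x) = 0 := by
            rw [← Measure.measure_univ_eq_zero]
            exact (measureReal_eq_zero_iff).1 hm0.symm
          have : A = 0 := by rw [hA, hz, integral_zero_measure]
          rw [← hm0, this]
          simp
        · have : 0 ≤ m * (m * B - A ^ 2) := by linarith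
          exact nonneg_of_mul_nonneg_right this hm0
      have hlen : (volume.restrict (Ioo y x)).real univ ≤ T / n := by
        rw [measureReal_restrict_apply_univ, Real.volume_real_Ioo_of_le hyx]
        nlinarith [hx.2, hy.1]
      have hmono : ∫ t in Ioo y x, g t ^ 2 ≤ ∫ t in elem T n i, g t ^ 2 :=
        setIntegral_mono_set hsq (Filter.Eventually.of_forall fun t => sq_nonneg _)
          hIoo.eventuallyLE
      have hB0 : 0 ≤ ∫ t in Ioo y x, g t ^ 2 := integral_nonneg fun t => sq_nonneg _
      calc _ ≤ (volume.restrict (Ioo y x)).real univ * ∫ t in Ioo y x, g t ^ 2 := by linarith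
        _ ≤ _ := by gcongr
    intro x hx y hy
    rcases le_total y x with hyx | hyx
    · exact hle x hx y hy hyx
    · rw [sub_sq_comm]
      exact hle y hy x hx hyx
  have hpt : ∀ i ∈ Finset.range n, ∫⁻ x in elem T n i, ∫⁻ y in elem T n i,
      ENNReal.ofReal ((u x - u y) ^ 2) ≤
      ENNReal.ofReal ((T / n) ^ 3 * ∫ t in elem T n i, g t ^ 2) := by
    intro i hi
    have hsub := elem_subset' hT (Finset.mem_range.1 hi)
    have hae := ae_restrict_of_ae_restrict_of_subset hsub ha
    have hmem := ae_restrict_mem (μ := volume) (measurableSet_Ioo : MeasurableSet (elem T n i))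
    have hB0 : 0 ≤ ∫ t in elem T n i, g t ^ 2 := integral_nonneg fun t => sq_nonneg _
    have hvol : volume (elem T n i) = ENNReal.ofReal (T / n) := by
      rw [Real.volume_Ioo]
      congr 1
      ring
    calc _ ≤ ∫⁻ _ in elem T n i, ∫⁻ _ in elem T n i,
          ENNReal.ofReal (T / n * ∫ t in elem T n i, g t ^ 2) := by
          refine lintegral_mono_ae ?_
          filter_upwards [hae, hmem] with x hx hxm
          refine lintegral_mono_ae ?_
          filter_upwards [hae, hmem] with y hy hym
          refine ENNReal.ofReal_le_ofReal ?_
          rw [hx, hy, add_sub_add_left_eq_sub]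
          exact hcs i hi x hxm y hym
      _ = _ := by
          rw [setLIntegral_const, setLIntegral_const, hvol, ← ENNReal.ofReal_mul (by positivity),
            ← ENNReal.ofReal_mul (by positivity)]
          congr 1
          ring
  have hfin := (ofReal_norm_sub_projL2_sq hT hn u).trans
    (mul_le_mul_right (Finset.sum_le_sum hpt) _)
  rw [← ENNReal.ofReal_sum_of_nonneg (fun i _ => mul_nonneg (by positivity)
    (integral_nonneg fun t => sq_nonneg _)), ← Finset.mul_sum,
    sum_integral_elem hT hn (integrableOn_sq g), ← norm_sq_eq_integral,
    ← ENNReal.ofReal_mul (by positivity), ENNReal.ofReal_le_ofReal_iff (by positivity)] at hfin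
  refine le_of_sq_le_sq (hfin.trans (le_of_eq ?_)) (by positivity)
  field_simp

theorem ofReal_le_rpow_half {r : ℝ} (hr : 0 ≤ r) {S : ℝ≥0∞} (h : ENNReal.ofReal (r ^ 2) ≤ S) :
    ENNReal.ofReal r ≤ S ^ (1 / 2 : ℝ) := by
  calc ENNReal.ofReal r = ENNReal.ofReal (r ^ 2) ^ (1 / 2 : ℝ) := by
        rw [ENNReal.ofReal_rpow_of_nonneg (by positivity) (by norm_num), ← Real.sqrt_eq_rpow,
          Real.sqrt_sq hr]
    _ ≤ _ := ENNReal.rpow_le_rpow h (by norm_num)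

/-- A lower bound for the Sobolev norm that holds for all weak jets. -/
theorem le_sobolevNorm {s : ℝ} {u : L2 T} (hu : MemSobolev T s u) {r : ℝ} (hr : 0 ≤ r)
    (h : ∀ g : ℕ → L2 T, IsWeakJet T ⌊s⌋₊ u g → ENNReal.ofReal (r ^ 2) ≤
      ∑ j ∈ Finset.range (⌊s⌋₊ + 1), ENNReal.ofReal (‖g j‖ ^ 2) +
        if 0 < s - ⌊s⌋₊ then slobodeckijSq T (s - ⌊s⌋₊) (g ⌊s⌋₊) else 0) :
    r ≤ sobolevNorm T s u := by
  rw [sobolevNorm, ← ENNReal.ofReal_le_iff_le_toReal hu.ne]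
  exact le_iInf₂ fun g hg => ofReal_le_rpow_half hr (h g hg)

theorem norm_sub_projL2_le (hT : 0 < T) (hn : 0 < n) {s : ℝ} (hs0 : 0 ≤ s) (hs1 : s ≤ 1)
    {u : L2 T} (hu : MemSobolev T s u) :
    ‖u - projL2 T n u‖ ≤ (T / n) ^ s * sobolevNorm T s u := by
  have h0 : (0 : ℝ) < n := by exact_mod_cast hn
  have hh : 0 < T / n := by positivity
  have hhs : 0 < (T / n) ^ s := Real.rpow_pos_of_pos hh s
  rw [← div_le_iff₀' hhs]
  refine le_sobolevNorm hu (by positivity) fun g hg => ?_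
  rcases hs1.eq_or_lt with rfl | hs1
  · rw [Nat.floor_one, Real.rpow_one] at *
    have h1 := norm_sub_projL2_le_of_isWeakDeriv (n := n) hT hn (hg.2 0 one_pos)
    rw [hg.1, zero_add] at h1
    refine le_trans (ENNReal.ofReal_le_ofReal (q := ‖g 1‖ ^ 2) ?_) (le_trans ?_ le_self_add)
    · gcongr
      rwa [div_le_iff₀' hh]
    · exact Finset.single_le_sum (f := fun j => ENNReal.ofReal (‖g j‖ ^ 2))
        (fun _ _ => zero_le) (by simp)
  · have hfl : ⌊s⌋₊ = 0 := Nat.floor_eq_zero.2 hs1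
    rw [hfl] at hg ⊢
    rw [hg.1, Nat.cast_zero, sub_zero]
    rcases hs0.eq_or_lt with rfl | hs0
    · have h1 : ‖u - projL2 T n u‖ ≤ ‖u‖ := by
        have := Submodule.starProjection_minimal (U := pwConst T n) u
        rw [projL2, this]
        exact (ciInf_le ⟨0, by rintro _ ⟨x, rfl⟩; exact norm_nonneg _⟩
          (0 : pwConst T n)).trans (by simp)
      refine le_trans ?_ le_self_add
      rw [zero_add, Finset.sum_range_one, hg.1, Real.rpow_zero, div_one]
      exact ENNReal.ofReal_le_ofReal (by gcongr)
    · rw [if_pos hs0]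
      refine le_trans ?_ le_add_self
      rw [div_pow, ENNReal.ofReal_div_of_pos (by positivity)]
      refine ENNReal.div_le_of_le_mul' ?_
      exact ofReal_sq_norm_le_of_slobodeckij hT hn hs0 u

/-! ### Second order Sobolev functions -/

theorem stepFn_ae_eq_one : ∀ᵐ t ∂volume.restrict (Ioo 0 T), stepFn T T t = 1 := by
  filter_upwards [indicatorConstLp_coeFn (p := 2)
    (hs := (measurableSet_Ioo : MeasurableSet (Ioo 0 T)))
    (hμs := measure_ne_top (volume.restrict (Ioo (0 : ℝ) T)) (Ioo 0 T)) (c := (1 : ℝ)),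
    ae_restrict_mem measurableSet_Ioo] with t ht htm
  rw [stepFn, ht, indicator_of_mem htm]

/-- The constant functions are piecewise constant. -/
theorem stepFn_mem (hT : 0 < T) (hn : 0 < n) : stepFn T T ∈ pwConst T n := by
  have h0 : (0 : ℝ) < n := by exact_mod_cast hn
  have hz : stepFn T 0 = 0 := by
    rw [← norm_eq_zero, ← sq_eq_zero_iff, norm_stepFn_sq le_rfl hT.le]
  have h : ∑ i : Fin n, basisFn T n i = stepFn T T := by
    have h1 : ∀ i : Fin n, basisFn T n i =
        stepFn T (((i : ℕ) + 1 : ℕ) * (T / n)) - stepFn T (((i : ℕ) : ℝ) * (T / n)) := fun i => by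
      rw [basisFn_eq_sub hT]
      push_cast
      rfl
    simp_rw [h1]
    rw [Fin.sum_univ_eq_sum_range (fun i : ℕ =>
      stepFn T ((i + 1 : ℕ) * (T / n)) - stepFn T ((i : ℝ) * (T / n))),
      Finset.sum_range_sub (fun i : ℕ => stepFn T ((i : ℝ) * (T / n)))]
    rw [Nat.cast_zero, zero_mul, hz, sub_zero, show (n : ℝ) * (T / n) = T by field_simp]
  rw [← h]
  exact Submodule.sum_mem _ fun i _ => basisFn_mem i

theorem cos_freq_mul_self (hT : 0 < T) (k : ℕ) : Real.cos (freq T k * T) = 0 := by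
  rw [freq, div_mul_cancel₀ _ hT.ne', Real.cos_add_nat_mul_pi, Real.cos_pi_div_two, mul_zero]

/-- If `∂ₜu(0) = 0`, then, up to a constant, two integrations by parts without boundary terms give
the decay of the cosine coefficients of `u`. -/
theorem exists_cosCoeff_sub_eq (hT : 0 < T) {u g₁ g₂ : L2 T} (h₁ : IsWeakDeriv T u g₁)
    (h₂ : IsWeakDeriv T g₁ g₂) (h0 : DerivZeroAtZero T u) :
    ∃ c : ℝ, ∀ k, freq T k ^ 2 * cosCoeff T (u - c • stepFn T T) k = -cosCoeff T g₂ k := by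
  obtain ⟨g, v, hg, hv, hgv, hv0⟩ := h0
  obtain rfl := hg.unique h₁
  obtain ⟨a, ha⟩ := h₁.exists_ae_eq hT
  obtain ⟨b, hb⟩ := h₂.exists_ae_eq hT
  have hi1 := intervalIntegrable_L2 hT g
  have hi2 := intervalIntegrable_L2 hT g₂
  -- two continuous representatives of the derivative agree up to the boundary
  have hb0 : b = 0 := by
    have hc : ContinuousOn (fun t => b + ∫ x in (0 : ℝ)..t, g₂ x) (Icc 0 T) := by
      have := (hi2.absolutelyContinuousOnInterval_intervalIntegral (c := 0) (by simp)).continuousOn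
      rw [uIcc_of_le hT.le] at this
      exact continuousOn_const.add this
    have hae : v =ᵐ[volume.restrict (Icc 0 T)] fun t => b + ∫ x in (0 : ℝ)..t, g₂ x := by
      rw [← restrict_Ioo_eq_restrict_Icc]
      exact hgv.symm.trans hb
    have := Measure.eqOn_Icc_of_ae_eq volume hT.ne hae hv hc (left_mem_Icc.2 hT.le)
    simpa [hv0] using this.symm
  subst hb0
  set c := a + ∫ x in (0 : ℝ)..T, g x with hc
  refine ⟨c, fun k => ?_⟩
  have hw := (freq_pos hT k).ne'
  have hlin : ∀ t, HasDerivAt (fun t : ℝ => freq T k * t) (freq T k) t := fun t => by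
    simpa using (hasDerivAt_id t).const_mul (freq T k)
  have e1 : ∫ t in Ioo 0 T, (u - c • stepFn T T) t * Real.cos (freq T k * t) =
      ∫ t in Ioo 0 T, ((a - c) + ∫ x in (0 : ℝ)..t, g x) *
        (Real.cos (freq T k * t) * freq T k / freq T k) := by
    refine integral_congr_ae ?_
    filter_upwards [ha, stepFn_ae_eq_one, Lp.coeFn_sub u (c • stepFn T T),
      Lp.coeFn_smul c (stepFn T T)] with t h1 h2 h3 h4
    rw [h3, Pi.sub_apply, h4, Pi.smul_apply, h2, h1, mul_div_cancel_right₀ _ hw, smul_eq_mul]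
    ring
  have e2 := integral_primitive_mul_deriv hT hi1 (a - c)
    (φ := fun t => Real.sin (freq T k * t) / freq T k)
    (φ' := fun t => Real.cos (freq T k * t) * freq T k / freq T k)
    (fun t => ((hlin t).sin).div_const _) (by fun_prop)
  have e3 : ∫ t in Ioo 0 T, g t * (Real.sin (freq T k * t) / freq T k) =
      ∫ t in Ioo 0 T, (0 + ∫ x in (0 : ℝ)..t, g₂ x) *
        (-(-Real.sin (freq T k * t) * freq T k) / freq T k ^ 2) := by
    refine integral_congr_ae ?_
    filter_upwards [hb] with t h1
    rw [h1]
    field_simp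
  have e4 := integral_primitive_mul_deriv hT hi2 0
    (φ := fun t => -Real.cos (freq T k * t) / freq T k ^ 2)
    (φ' := fun t => -(-Real.sin (freq T k * t) * freq T k) / freq T k ^ 2)
    (fun t => ((hlin t).cos).neg.div_const _) (by fun_prop)
  have e5 : ∫ t in Ioo 0 T, g₂ t * (-Real.cos (freq T k * t) / freq T k ^ 2) =
      -(∫ t in Ioo 0 T, g₂ t * Real.cos (freq T k * t)) / freq T k ^ 2 := by
    rw [← integral_neg, ← integral_div]
    congr 1
    ext t
    ring
  rw [e3, e4, e5] at e2
  simp only [cos_freq_mul_self hT, mul_zero, Real.sin_zero, zero_div, zero_mul, neg_zero,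
    sub_zero, zero_sub] at e2
  rw [show a - c + ∫ x in (0 : ℝ)..T, g x = 0 by rw [hc]; ring] at e2
  rw [cosCoeff, cosCoeff, e1, e2]
  field_simp
  ring

theorem norm_discreteOp_le_of_derivZeroAtZero (hT : 0 < T) (hn : 0 < n) {u g₁ g₂ : L2 T}
    (h₁ : IsWeakDeriv T u g₁) (h₂ : IsWeakDeriv T g₁ g₂) (h0 : DerivZeroAtZero T u) :
    ‖projL2 T n (hilbTInv T (u - projL2 T n u))‖ ≤ 3 * (T / n) ^ 2 * ‖g₂‖ := by
  obtain ⟨c, hc⟩ := exists_cosCoeff_sub_eq hT h₁ h₂ h0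
  have hmem : c • stepFn T T ∈ pwConst T n := Submodule.smul_mem _ _ (stepFn_mem hT hn)
  have e : u - projL2 T n u =
      (u - c • stepFn T T) - projL2 T n (u - c • stepFn T T) := by
    have h : projL2 T n (u - c • stepFn T T) = projL2 T n u - c • stepFn T T := by
      rw [projL2, map_sub, Submodule.starProjection_eq_self_iff.2 hmem]
      rfl
    rw [h]
    abel
  rw [e]
  refine norm_discreteOp_sub_projL2_le hT hn fun k => ?_
  rw [← abs_neg (cosCoeff T g₂ k), ← hc, abs_mul, abs_of_nonneg (sq_nonneg (freq T k))]

theorem norm_sub_le_add (u uh : L2 T) :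
    ‖u - uh‖ ≤ ‖u - projL2 T n u‖ + ‖uh - projL2 T n u‖ := by
  rw [← sub_sub_sub_cancel_right u uh (projL2 T n u)]
  exact norm_sub_le _ _

theorem norm_sub_le_sobolevNorm_two (hT : 0 < T) (hn : 0 < n) {u uh : L2 T}
    (huh : IsHilbProj T n u uh) (hu : MemSobolev T 2 u) (h0 : DerivZeroAtZero T u) :
    ‖u - uh‖ ≤ (1 + 3 * Real.pi ^ 2 / 2 * T) * (T / n) * sobolevNorm T 2 u := by
  have hn0 : (0 : ℝ) < n := by exact_mod_cast hn
  have hh : 0 < T / n := by positivity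
  have hp := Real.pi_pos
  set c := 1 + 3 * Real.pi ^ 2 / 2 * T with hc
  have hc0 : 0 < c := by positivity
  rw [← div_le_iff₀' (by positivity)]
  refine le_sobolevNorm hu (by positivity) fun g hg => ?_
  rw [Nat.floor_ofNat] at hg ⊢
  have hd1 : IsWeakDeriv T u (g 1) := by
    have := hg.2 0 two_pos
    rwa [hg.1] at this
  have hd2 : IsWeakDeriv T (g 1) (g 2) := hg.2 1 one_lt_two
  have h1 := norm_sub_projL2_le_of_isWeakDeriv hT hn hd1
  have h2 : ‖uh - projL2 T n u‖ ≤ 3 * Real.pi ^ 2 / 2 * T * (T / n) * ‖g 2‖ := by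
    refine (norm_le_mul_norm_discreteOp hT hn
      (Submodule.sub_mem _ huh.1 (projL2_mem u))).trans ?_
    rw [projL2_hilbTInv_sub hT huh]
    refine (mul_le_mul_of_nonneg_left
      (norm_discreteOp_le_of_derivZeroAtZero hT hn hd1 hd2 h0) (by positivity)).trans (le_of_eq ?_)
    field_simp
  have h3 : ‖u - uh‖ / (c * (T / n)) ≤ Real.sqrt (‖g 1‖ ^ 2 + ‖g 2‖ ^ 2) := by
    have s1 : ‖g 1‖ ≤ Real.sqrt (‖g 1‖ ^ 2 + ‖g 2‖ ^ 2) :=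
      Real.le_sqrt_of_sq_le (by linarith [sq_nonneg ‖g 2‖])
    have s2 : ‖g 2‖ ≤ Real.sqrt (‖g 1‖ ^ 2 + ‖g 2‖ ^ 2) :=
      Real.le_sqrt_of_sq_le (by linarith [sq_nonneg ‖g 1‖])
    rw [div_le_iff₀' (by positivity)]
    calc ‖u - uh‖ ≤ T / n * ‖g 1‖ + 3 * Real.pi ^ 2 / 2 * T * (T / n) * ‖g 2‖ :=
          (norm_sub_le_add u uh).trans (add_le_add h1 h2)
      _ ≤ T / n * Real.sqrt (‖g 1‖ ^ 2 + ‖g 2‖ ^ 2) +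
          3 * Real.pi ^ 2 / 2 * T * (T / n) * Real.sqrt (‖g 1‖ ^ 2 + ‖g 2‖ ^ 2) := by gcongr
      _ = _ := by rw [hc]; ring
  have h4 := pow_le_pow_left₀ (by positivity) h3 2
  rw [Real.sq_sqrt (by positivity)] at h4
  refine le_trans (ENNReal.ofReal_le_ofReal h4) (le_trans ?_ le_self_add)
  rw [ENNReal.ofReal_add (sq_nonneg _) (sq_nonneg _)]
  simp only [Finset.sum_range_succ, Finset.sum_range_zero, zero_add]
  rw [add_assoc]
  exact le_add_self

theorem norm_sub_le_sobolevNorm_add (hT : 0 < T) (hn : 0 < n) {u uh : L2 T}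
    (huh : IsHilbProj T n u uh) {s : ℝ} (hs0 : 0 ≤ s) (hs1 : s ≤ 1) (hu : MemSobolev T s u) :
    ‖u - uh‖ ≤ (T / n) ^ s * sobolevNorm T s u +
      ‖projL2 T n (hilbTInv T (u - projL2 T n u))‖ / stabConst T n (uh - projL2 T n u) := by
  have hmem : uh - projL2 T n u ∈ pwConst T n := Submodule.sub_mem _ huh.1 (projL2_mem u)
  refine (norm_sub_le_add u uh).trans (add_le_add (norm_sub_projL2_le hT hn hs0 hs1 hu) ?_)
  rw [le_div_iff₀' (stabConst_pos hT hn hmem), ← projL2_hilbTInv_sub hT huh]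
  exact stabConst_mul_norm_le hT hn hmem

end ModHilbert

end

theorem mainTheorem3 (T : ℝ) (hT : 0 < T) :
    ∃ c : ℝ, 0 < c ∧ ∀ n : ℕ, 0 < n → ∀ u : L2 T,
      (∃! uh : L2 T, IsHilbProj T n u uh) ∧
      ∀ uh : L2 T, IsHilbProj T n u uh →
        (∀ s : ℝ, 0 ≤ s → s ≤ 1 → MemSobolev T s u →
          ‖u - uh‖ ≤ c * ((T / n) ^ s * sobolevNorm T s u +
            ‖projL2 T n (hilbTInv T (u - projL2 T n u))‖ /
              stabConst T n (uh - projL2 T n u))) ∧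
        (MemSobolev T 2 u → DerivZeroAtZero T u →
          ‖u - uh‖ ≤ c * (T / n) * sobolevNorm T 2 u) := by
  have hp := Real.pi_pos
  have hc : 1 ≤ 1 + 3 * Real.pi ^ 2 / 2 * T := le_add_of_nonneg_right (by positivity)
  refine ⟨1 + 3 * Real.pi ^ 2 / 2 * T, by positivity, fun n hn u =>
    ⟨existsUnique_isHilbProj hT hn u, fun uh huh => ⟨fun s hs0 hs1 hu => ?_, fun hu h0 =>
      norm_sub_le_sobolevNorm_two hT hn huh hu h0⟩⟩⟩
  have h := norm_sub_le_sobolevNorm_add hT hn huh hs0 hs1 hu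
  exact h.trans (le_mul_of_one_le_left ((norm_nonneg _).trans h) hc)
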